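/- A pencil is a complex matrix polynomial $P(\lambda)=\lambda P_1-P_0$ with constant matrices $P_1,P_0$; a square pencil is regular if $\det P(\lambda)\not\equiv 0$. Its finite eigenvalues $\lambda_0\in\mathbb C$ and their block sizes (partial multiplicities) are given by the elementary divisors $(\lambda-\lambda_0)^{k}$, $k\ge1$, of $P(\lambda)$; its eigenvalue at $\infty$ and the block sizes there are given by the elementary divisors $\mu^{k}$, $k\ge 1$, of the reversed pencil $P_1-\mu P_0$. The multiplicity of an eigenvalue is the sum of its block sizes. A quadruple of pencils $\{A,B,C,D\}$ with $A(\lambda)$ regular realizes the rational matrix $R(\lambda)=C(\lambda)A(\lambda)^{-1}B(\lambda)+D(\lambda)$. **Theorem.** Let $d,m,n\ge 0$ and let $A(\lambda)$, $B(\lambda)$, $C(\lambda)$, $D(\lambda)$ be complex pencils of sizes $d\times d$, $d\times n$, $m\times d$, $m\times n$, with $A(\lambda)$ regular, and let $R(\lambda):=C(\lambda)A(\lambda)^{-1}B(\lambda)+D(\lambda)\in\mathbb C(\lambda)^{m\times n}$. Then there exist integers $d_{\bar c},d_c\ge 0$ with $d_{\bar c}+d_c=d$, unitary matrices $U,V\in\mathbb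 C^{d\times d}$, and a unitary matrix $$\widetilde W=\begin{bmatrix}\widetilde W_{11}&0&\widetilde W_{13}\\0&I_{d_c}&0\\ \widetilde W_{31}&0&\widetilde W_{33}\end{bmatrix}\in\mathbb C^{(d_{\bar c}+d_c+n)\times(d_{\bar c}+d_c+n)},$$ such that $$\begin{bmatrix}U&0\\0&I_m\end{bmatrix}\begin{bmatrix}A(\lambda)&-B(\lambda)\\C(\lambda)&D(\lambda)\end{bmatrix}\begin{bmatrix}V&0\\0&I_n\end{bmatrix}\widetilde W=\begin{bmatrix}X_{\bar c}(\lambda)&0&0\\Y_{\bar c}(\lambda)&A_c(\lambda)&-B_c(\lambda)\\Z_{\bar c}(\lambda)&C_c(\lambda)&D_c(\lambda)\end{bmatrix},$$ where all blocks on the right are pencils, $X_{\bar c}(\lambda)$ is regular of size $d_{\bar c}\times d_{\bar c}$, $A_c(\lambda)$ is of size $d_c\times d_c$, and $d_{\bar c}$ is the number of finite and infinite eigenvalues of $[A(\lambda)\;\;{-B(\lambda)}]$, counted with multiplicity. Moreover: a) the eigenvalues of $[A(\lambda)\;\;{-B(\lambda)}]$ are the eigenvalues of $X_{\bar c}(\lambda)$: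 at every point of $\mathbb C\cup\{\infty\}$ the two pencils have the same block sizes; b) $[A_c(\lambda)\;\;{-B_c(\lambda)}]$ has no finite or infinite eigenvalues; c) $A_c(\lambda)$ is regular, the quadruple $\{A_c,B_c,C_c,D_c\}$ realizes $R(\lambda)\widetilde W_{33}$, that is, $C_c(\lambda)A_c(\lambda)^{-1}B_c(\lambda)+D_c(\lambda)=R(\lambda)\widetilde W_{33}$, and $\widetilde W_{33}\in\mathbb C^{n\times n}$ is invertible; d) if $\begin{bmatrix}A(\lambda)\\C(\lambda)\end{bmatrix}$ has no finite or infinite eigenvalues, then $\begin{bmatrix}A_c(\lambda)\\C_c(\lambda)\end{bmatrix}$ has no finite or infinite eigenvalues. -/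

import Mathlib

open Polynomial

noncomputable section

/-- A matrix pencil `P(lam) = lam * lead - const` with complex coefficients (a polynomial matrix
considered with grade one). -/
@[ext]
structure Pencil (m n : Type) where
  /-- the coefficient of the indeterminate -/
  lead : Matrix m n ℂ
  /-- minus the constant coefficient -/
  const : Matrix m n ℂ

namespace Pencil

variable {m m₁ m₂ n n₁ n₂ : Type}

instance : Neg (Pencil m n) := ⟨fun P => ⟨-P.lead, -P.const⟩⟩

/-- The pencil `lam * lead - const` as a polynomial matrix. -/
def poly (P : Pencil m n) : Matrix m n ℂ[X] :=
  (X : ℂ[X]) • P.lead.map C - P.const.map C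

/-- The reversed pencil `lead - mu * const`. -/
def rev (P : Pencil m n) : Matrix m n ℂ[X] :=
  P.lead.map C - (X : ℂ[X]) • P.const.map C

/-- The pencil as a matrix over the field of rational functions. -/
def ratFunc (P : Pencil m n) : Matrix m n (RatFunc ℂ) :=
  P.poly.map (algebraMap ℂ[X] (RatFunc ℂ))

/-- The pencil `[P Q]`. -/
def fromCols (P : Pencil m n₁) (Q : Pencil m n₂) : Pencil m (n₁ ⊕ n₂) :=
  ⟨Matrix.fromCols P.lead Q.lead, Matrix.fromCols P.const Q.const⟩

/-- The pencil `[P; Q]`. -/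
def fromRows (P : Pencil m₁ n) (Q : Pencil m₂ n) : Pencil (m₁ ⊕ m₂) n :=
  ⟨Matrix.fromRows P.lead Q.lead, Matrix.fromRows P.const Q.const⟩

/-- A square pencil is regular if its determinant is not identically zero. -/
def IsRegular [Fintype n] [DecidableEq n] (P : Pencil n n) : Prop :=
  P.poly.det ≠ 0

end Pencil

/-- The ideal generated by the `k × k` minors of a polynomial matrix. (A choice of rows or of
columns with a repetition only contributes a zero determinant.) -/
def minorIdeal {m n : Type} (M : Matrix m n ℂ[X]) (k : ℕ) : Ideal ℂ[X] :=
  Ideal.span {p | ∃ (f : Fin k → m) (g : Fin k → n), p = (M.submatrix f g).det}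

/-- The `k`-th determinantal divisor: the greatest common divisor of all `k × k` minors, unique up
to a nonzero constant factor. -/
def detDivisor {m n : Type} (M : Matrix m n ℂ[X]) (k : ℕ) : ℂ[X] :=
  Submodule.IsPrincipal.generator (minorIdeal M k)

/-- The normal rank: the size of the largest minor that is not identically zero. -/
def normalRank {m n : Type} (M : Matrix m n ℂ[X]) : ℕ :=
  sSup {k | minorIdeal M k ≠ ⊥}

/-- The exponents of the elementary divisors of `M` at the point `a`: the nonzero ones among the
multiplicities of `a` as a root of the invariant polynomials `D_{k+1} / D_k`, `k < normalRank M`,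
where `D_k` is the `k`-th determinantal divisor. -/
def elementaryExponents {m n : Type} (M : Matrix m n ℂ[X]) (a : ℂ) : Multiset ℕ :=
  ((Multiset.range (normalRank M)).map fun k =>
    (detDivisor M (k + 1)).rootMultiplicity a - (detDivisor M k).rootMultiplicity a).filter (· ≠ 0)

/-- Determinantal divisors divide each other successively. -/
theorem detDivisor_dvd_succ {m n : Type} (M : Matrix m n ℂ[X]) (k : ℕ) :
    detDivisor M k ∣ detDivisor M (k + 1) := by
  have hle : minorIdeal M (k + 1) ≤ minorIdeal M k := by
    refine Ideal.span_le.2 ?_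
    rintro p ⟨f, g, rfl⟩
    rw [Matrix.det_succ_row_zero]
    refine Ideal.sum_mem _ fun j _ => Ideal.mul_mem_left _ _ (Ideal.subset_span ?_)
    exact ⟨f ∘ Fin.succ, g ∘ j.succAbove, rfl⟩
  exact (Submodule.IsPrincipal.mem_iff_generator_dvd _).1
    (hle (Submodule.IsPrincipal.generator_mem _))

namespace Pencil

variable {m n : Type}

/-- The sizes of the Kronecker (Jordan) blocks of the pencil at a point of `ℂ ∪ {∞}`. At infinity
these are the exponents of the elementary divisors at zero of the reversed pencil. -/
def blockSizes (P : Pencil m n) (z : OnePoint ℂ) : Multiset ℕ :=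
  z.elim (elementaryExponents P.rev 0) (elementaryExponents P.poly)

/-- `z` in `ℂ ∪ {∞}` is a (finite or infinite) eigenvalue of the pencil. -/
def IsEigenvalue (P : Pencil m n) (z : OnePoint ℂ) : Prop :=
  P.blockSizes z ≠ 0

/-- The number of finite and infinite eigenvalues, counted with multiplicity. -/
def numEigenvalues (P : Pencil m n) : ℕ :=
  ∑ᶠ z : OnePoint ℂ, (P.blockSizes z).sum

/-- A pencil has only finitely many eigenvalues, so that the sum above is a finite one. -/
theorem finite_setOf_isEigenvalue (P : Pencil m n) : {z | P.IsEigenvalue z}.Finite := by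
  classical
  refine Set.Finite.subset (((Finset.range (normalRank P.poly)).biUnion fun k =>
    (detDivisor P.poly (k + 1)).roots.toFinset).finite_toSet.image
      ((↑) : ℂ → OnePoint ℂ) |>.insert OnePoint.infty) ?_
  intro z hz
  induction z using OnePoint.rec with
  | infty => exact Set.mem_insert _ _
  | coe a =>
    refine Set.mem_insert_of_mem _ ⟨a, ?_, rfl⟩
    obtain ⟨e, he⟩ := Multiset.exists_mem_of_ne_zero hz
    change e ∈ elementaryExponents P.poly a at he
    simp only [elementaryExponents, Multiset.mem_filter, Multiset.mem_map,
      Multiset.mem_range] at he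
    obtain ⟨⟨k, hk, rfl⟩, hne⟩ := he
    simp only [Finset.coe_biUnion, Set.mem_iUnion, Finset.mem_coe, Finset.mem_range,
      Multiset.mem_toFinset]
    refine ⟨k, hk, ?_⟩
    rw [← Multiset.count_pos, count_roots]
    omega

end Pencil

/-- The system matrix `[A -B; C D]` of a linear system quadruple. -/
def systemMatrix {d m n : Type} (A : Pencil d d) (B : Pencil d n) (C : Pencil m d)
    (D : Pencil m n) : Matrix (d ⊕ m) (d ⊕ n) ℂ[X] :=
  Matrix.fromBlocks A.poly (-B.poly) C.poly D.poly

/-- The transfer function `C A⁻¹ B + D` of a linear system quadruple. -/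
def transferFunction {d m n : Type} [Fintype d] [DecidableEq d] (A : Pencil d d) (B : Pencil d n)
    (C : Pencil m d) (D : Pencil m n) : Matrix m n (RatFunc ℂ) :=
  C.ratFunc * A.ratFunc⁻¹ * B.ratFunc + D.ratFunc

/-- The quadruple `{A, B, C, D}`, with `A` regular, realizes the rational matrix `R`. -/
def Realizes {d m n : Type} [Fintype d] [DecidableEq d] (A : Pencil d d) (B : Pencil d n)
    (C : Pencil m d) (D : Pencil m n) (R : Matrix m n (RatFunc ℂ)) : Prop :=
  A.IsRegular ∧ R = transferFunction A B C D

/-- The block matrix `[W₁₁ 0 W₁₃; 0 I 0; W₃₁ 0 W₃₃]`. -/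
def blockW {r s n : Type} [DecidableEq s] (W₁₁ : Matrix r r ℂ) (W₁₃ : Matrix r n ℂ)
    (W₃₁ : Matrix n r ℂ) (W₃₃ : Matrix n n ℂ) : Matrix ((r ⊕ s) ⊕ n) ((r ⊕ s) ⊕ n) ℂ :=
  Matrix.fromBlocks (Matrix.fromBlocks W₁₁ 0 0 1) (Matrix.fromRows W₁₃ 0)
    (Matrix.fromCols W₃₁ 0) W₃₃

/-- The polynomial matrix `[X 0 0; Y A -B; Z C D]`. -/
def blockTriangular {r s m n : Type} (Xc : Pencil r r) (Y : Pencil s r) (Z : Pencil m r)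
    (A : Pencil s s) (B : Pencil s n) (C : Pencil m s) (D : Pencil m n) :
    Matrix ((r ⊕ s) ⊕ m) ((r ⊕ s) ⊕ n) ℂ[X] :=
  Matrix.fromBlocks (Matrix.fromBlocks Xc.poly 0 Y.poly A.poly) (Matrix.fromRows 0 (-B.poly))
    (Matrix.fromCols Z.poly C.poly) D.poly

/-- The block diagonal matrix `[U 0; 0 I]` with constant entries, as a polynomial matrix. -/
def diagOne {d : Type} (m : Type) [DecidableEq m] (U : Matrix d d ℂ) : Matrix (d ⊕ m) (d ⊕ m) ℂ[X] :=
  (Matrix.fromBlocks U 0 0 1).map C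

/-- For `r + s = d`, the splitting of the `d` indices into the first `r` and the last `s`, the
remaining `k` indices being unchanged. -/
def splitIndex {r s d : ℕ} (h : r + s = d) (k : ℕ) :
    Fin d ⊕ Fin k ≃ (Fin r ⊕ Fin s) ⊕ Fin k :=
  Equiv.sumCongr ((finSumFinEquiv.trans (finCongr h)).symm) (Equiv.refl _)

end

/-! ### Determinantal ideals: products, identity summands, right invertibility. -/

section Minors

variable {m n p q r s : Type}

/-! Write `[A -B]` as `λP₁ - P₀`. Consider pairs of subspaces `S` of `ℂ^(d+n)` and `L` of `ℂ^d` such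
that `P₁` and `P₀` map `S` into `L` and `dim S ≥ dim L + n`; the whole spaces form such a pair. If
`dim L` is minimal, then `αP₁ - βP₀` maps `S` onto `L` at every `(α, β) ≠ 0`, since a failure of
surjectivity yields a functional that cuts out a smaller pair. Regularity of `A` makes the pencil
surjective at some point, which forces `dim S = dim L + n` (`exists_deflating_pair`). The
restriction `S → L` has full row rank everywhere and becomes `[A_c -B_c]`; the pencil induced on the
quotients is square, of size `d - dim L`, and becomes `X`.

Unitary bases adapted to `S` and `L` give the staircase form (`exists_staircase`). The zero pattern
of `W` is obtained by taking part of the basis of `S` inside `ℂ^d ⊕ 0`; `W` then mixes only the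
remaining state directions with the inputs.

The block `[A_c -B_c]` has a polynomial right inverse, so it can be split off as an identity and the
determinantal ideals of `[A -B]` are those of `X`, shifted (`minorIdeal_fromBlocks_of_mul_eq_one`).
This gives a), and the count follows because a regular pencil has as many eigenvalues as its size.
Undoing `W` shows that `Q* A V` is block triangular with diagonal blocks `X W₁₁*` and `A_c`
(`mul_fromBlocks_of_staircase`); hence `X`, `A_c` and `W₁₁` are all nonsingular, and unitarity
transfers this from `W₁₁` to `W₃₃`. The relations `A V₂ = Q₂ A_c` and `C V₂ = C_c` carry the rest of
c), and d). -/

theorem minorIdeal_transpose (M : Matrix m n ℂ[X]) (k : ℕ) :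
    minorIdeal M.transpose k = minorIdeal M k := by
  unfold minorIdeal
  congr 1
  ext x
  constructor
  · rintro ⟨f, g, rfl⟩
    exact ⟨g, f, by rw [← Matrix.det_transpose, Matrix.transpose_submatrix,
      Matrix.transpose_transpose]⟩
  · rintro ⟨f, g, rfl⟩
    exact ⟨g, f, by rw [← Matrix.det_transpose, Matrix.transpose_submatrix]⟩

theorem det_submatrix_mem_minorIdeal (M : Matrix m n ℂ[X]) {k : ℕ} (f : Fin k → m)
    (g : Fin k → n) : (M.submatrix f g).det ∈ minorIdeal M k :=
  Ideal.subset_span ⟨f, g, rfl⟩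

theorem minorIdeal_submatrix_le (M : Matrix m n ℂ[X]) (f : p → m) (g : q → n) (k : ℕ) :
    minorIdeal (M.submatrix f g) k ≤ minorIdeal M k := by
  refine Ideal.span_le.2 ?_
  rintro x ⟨f', g', rfl⟩
  rw [Matrix.submatrix_submatrix]
  exact det_submatrix_mem_minorIdeal M _ _

/-- A weak Cauchy-Binet formula: the rows of a minor of `M * N` are combinations of rows of `N`, and
the determinant is multilinear in them. -/
theorem minorIdeal_mul_le_right [Fintype n] (M : Matrix m n ℂ[X]) (N : Matrix n p ℂ[X]) (k : ℕ) :
    minorIdeal (M * N) k ≤ minorIdeal N k := by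
  classical
  refine Ideal.span_le.2 ?_
  rintro x ⟨f, g, rfl⟩
  have h : ((M * N).submatrix f g) =
      fun i => ∑ j : n, M (f i) j • (N.submatrix id g) j := by
    ext i j
    simp [Matrix.mul_apply]
  have h2 : ((M * N).submatrix f g).det =
      Matrix.detRowAlternating.toMultilinearMap
        (fun i => ∑ j : n, M (f i) j • (N.submatrix id g) j) := by
    rw [h]; rfl
  rw [h2, MultilinearMap.map_sum]
  refine Ideal.sum_mem _ fun c _ => ?_
  rw [MultilinearMap.map_smul_univ]
  exact Ideal.mul_mem_left _ _ (det_submatrix_mem_minorIdeal N c g)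

theorem minorIdeal_mul_le_left [Fintype n] (M : Matrix m n ℂ[X]) (N : Matrix n p ℂ[X]) (k : ℕ) :
    minorIdeal (M * N) k ≤ minorIdeal M k := by
  rw [← minorIdeal_transpose (M * N), ← minorIdeal_transpose M, Matrix.transpose_mul]
  exact minorIdeal_mul_le_right _ _ k

theorem minorIdeal_zero (M : Matrix m n ℂ[X]) : minorIdeal M 0 = ⊤ := by
  rw [Ideal.eq_top_iff_one]
  have := det_submatrix_mem_minorIdeal M (Fin.elim0 : Fin 0 → m) (Fin.elim0 : Fin 0 → n)
  simpa using this

theorem minorIdeal_succ_le (M : Matrix m n ℂ[X]) (k : ℕ) :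
    minorIdeal M (k + 1) ≤ minorIdeal M k := by
  refine Ideal.span_le.2 ?_
  rintro p ⟨f, g, rfl⟩
  rw [Matrix.det_succ_row_zero]
  exact Ideal.sum_mem _ fun j _ => Ideal.mul_mem_left _ _
    (det_submatrix_mem_minorIdeal M (f ∘ Fin.succ) (g ∘ j.succAbove))

theorem minorIdeal_antitone (M : Matrix m n ℂ[X]) : Antitone (minorIdeal M) :=
  antitone_nat_of_succ_le (minorIdeal_succ_le M)

theorem det_submatrix_eq_zero_of_not_injective (M : Matrix m n ℂ[X]) {k : ℕ} (f : Fin k → m)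
    (g : Fin k → n) (hf : ¬ Function.Injective f) : (M.submatrix f g).det = 0 := by
  simp only [Function.Injective, not_forall] at hf
  obtain ⟨i, j, hij, hne⟩ := hf
  exact Matrix.det_zero_of_row_eq hne (by ext l; simp [hij])

theorem minorIdeal_eq_bot_of_card_lt [Fintype m] (M : Matrix m n ℂ[X]) {k : ℕ}
    (hk : Fintype.card m < k) : minorIdeal M k = ⊥ := by
  rw [eq_bot_iff]
  refine Ideal.span_le.2 ?_
  rintro p ⟨f, g, rfl⟩
  rw [det_submatrix_eq_zero_of_not_injective]
  · exact Submodule.zero_mem _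
  · intro hf
    have := Fintype.card_le_of_injective f hf
    simp at this
    omega

theorem minorIdeal_card [Fintype m] [DecidableEq m] (M : Matrix m m ℂ[X]) :
    minorIdeal M (Fintype.card m) = Ideal.span {M.det} := by
  apply le_antisymm
  · refine Ideal.span_le.2 ?_
    rintro p ⟨f, g, rfl⟩
    by_cases hf : Function.Injective f
    · by_cases hg : Function.Injective g
      · have hf' : Function.Bijective f :=
          (Fintype.bijective_iff_injective_and_card f).2 ⟨hf, by simp⟩
        have hg' : Function.Bijective g :=
          (Fintype.bijective_iff_injective_and_card g).2 ⟨hg, by simp⟩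
        have h : M.submatrix f g = ((M.submatrix id
            ((Equiv.ofBijective f hf').symm.trans (Equiv.ofBijective g hg'))).submatrix
            (Equiv.ofBijective f hf') (Equiv.ofBijective f hf')) := by
          ext i j
          simp only [Matrix.submatrix_apply, id, Equiv.trans_apply, Equiv.symm_apply_apply]
          rfl
        rw [h, Matrix.det_submatrix_equiv_self, Matrix.det_permute']
        exact Ideal.mul_mem_left _ _ (Ideal.subset_span rfl)
      · rw [← Matrix.det_transpose (M.submatrix f g), Matrix.transpose_submatrix,
          det_submatrix_eq_zero_of_not_injective _ _ _ hg]
        exact Submodule.zero_mem _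
    · rw [det_submatrix_eq_zero_of_not_injective _ _ _ hf]
      exact Submodule.zero_mem _
  · refine Ideal.span_le.2 ?_
    rintro p rfl
    have := det_submatrix_mem_minorIdeal M (Fintype.equivFin m).symm (Fintype.equivFin m).symm
    rwa [Matrix.det_submatrix_equiv_self] at this

/-- Every minor of `M` extends by all rows and columns of the identity block without changing its
value. -/
theorem minorIdeal_le_fromBlocks_one [Fintype s] [DecidableEq s] (M : Matrix m n ℂ[X]) (k : ℕ) :
    minorIdeal M k ≤ minorIdeal (Matrix.fromBlocks M 0 0 (1 : Matrix s s ℂ[X]))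
      (k + Fintype.card s) := by
  refine Ideal.span_le.2 ?_
  rintro p ⟨f, g, rfl⟩
  let e : Fin (k + Fintype.card s) ≃ Fin k ⊕ s :=
    finSumFinEquiv.symm.trans (Equiv.sumCongr (Equiv.refl _) (Fintype.equivFin s).symm)
  have h := det_submatrix_mem_minorIdeal (Matrix.fromBlocks M 0 0 (1 : Matrix s s ℂ[X]))
    (Sum.map f id ∘ e) (Sum.map g id ∘ e)
  rw [← Matrix.submatrix_submatrix, Matrix.det_submatrix_equiv_self] at h
  have h2 : (Matrix.fromBlocks M 0 0 (1 : Matrix s s ℂ[X])).submatrix (Sum.map f id)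
      (Sum.map g id) = Matrix.fromBlocks (M.submatrix f g) 0 0 1 := by
    ext (i | i) (j | j) <;> simp
  rw [h2, Matrix.det_fromBlocks_zero₂₁, Matrix.det_one, mul_one] at h
  exact h

/-- `T` contains the identity rows that may still occur. Expansion along one of them lowers the size
and `T.card` together. Once none is left, an identity column is zero, and without such columns the
determinant is a minor of `M`. -/
theorem det_submatrix_fromBlocks_one_mem [DecidableEq s] (M : Matrix m n ℂ[X]) (k : ℕ) :
    ∀ (T : Finset s) (f : Fin k → m ⊕ s) (g : Fin k → n ⊕ s), Function.Injective f →
      (∀ i x, f i = Sum.inr x → x ∈ T) →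
      ((Matrix.fromBlocks M 0 0 (1 : Matrix s s ℂ[X])).submatrix f g).det ∈
        minorIdeal M (k - T.card) := by
  induction k with
  | zero => intro T f g _ _; simp [minorIdeal_zero]
  | succ k ih =>
    intro T f g hf hT
    by_cases h : ∃ i x, f i = Sum.inr x
    · obtain ⟨i, x, hx⟩ := h
      rw [Matrix.det_succ_row _ i]
      refine Ideal.sum_mem _ fun j _ => Ideal.mul_mem_left _ _ ?_
      have hxT := hT i x hx
      have := ih (T.erase x) (f ∘ i.succAbove) (g ∘ j.succAbove)
        (hf.comp Fin.succAbove_right_injective) (by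
          intro i' x' hi'
          refine Finset.mem_erase.2 ⟨?_, hT _ _ hi'⟩
          rintro rfl
          exact Fin.succAbove_ne i i' (hf (hi'.trans hx.symm)))
      rw [Finset.card_erase_of_mem hxT] at this
      have hpos : 0 < T.card := Finset.card_pos.2 ⟨x, hxT⟩
      rw [show k + 1 - T.card = k - (T.card - 1) by omega, Matrix.submatrix_submatrix]
      exact this
    · by_cases h' : ∃ j x, g j = Sum.inr x
      · obtain ⟨j, x, hx⟩ := h'
        rw [Matrix.det_eq_zero_of_column_eq_zero j]
        · exact Submodule.zero_mem _
        · intro i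
          rcases hi : f i with y | y
          · simp [hi, hx]
          · exact absurd ⟨i, y, hi⟩ h
      · have hf' : ∀ i, ∃ y, f i = Sum.inl y := by
          intro i
          rcases hi : f i with y | y
          · exact ⟨y, rfl⟩
          · exact absurd ⟨i, y, hi⟩ h
        have hg' : ∀ i, ∃ y, g i = Sum.inl y := by
          intro i
          rcases hi : g i with y | y
          · exact ⟨y, rfl⟩
          · exact absurd ⟨i, y, hi⟩ h'
        choose f' hf' using hf'
        choose g' hg' using hg'
        have he : (Matrix.fromBlocks M 0 0 (1 : Matrix s s ℂ[X])).submatrix f g =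
            M.submatrix f' g' := by
          ext i j
          simp [hf', hg']
        rw [he]
        exact minorIdeal_antitone M (Nat.sub_le _ _) (det_submatrix_mem_minorIdeal M f' g')

theorem minorIdeal_fromBlocks_one [Fintype s] [DecidableEq s] (M : Matrix m n ℂ[X]) (k : ℕ) :
    minorIdeal (Matrix.fromBlocks M 0 0 (1 : Matrix s s ℂ[X])) (k + Fintype.card s) =
      minorIdeal M k := by
  refine le_antisymm (Ideal.span_le.2 ?_) (minorIdeal_le_fromBlocks_one M k)
  rintro p ⟨f, g, rfl⟩
  by_cases hf : Function.Injective f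
  · have := det_submatrix_fromBlocks_one_mem M _ Finset.univ f g hf (by simp)
    simpa using this
  · rw [det_submatrix_eq_zero_of_not_injective _ _ _ hf]
    exact Submodule.zero_mem _

/-- A block triangular matrix whose second diagonal block is right invertible has the minor ideals
of the first diagonal block, shifted. -/
theorem minorIdeal_fromBlocks_of_mul_eq_one [Fintype r] [DecidableEq r] [Fintype s] [DecidableEq s]
    [Fintype q] (M : Matrix r r ℂ[X]) (N : Matrix s r ℂ[X]) (S : Matrix s q ℂ[X])
    (T : Matrix q s ℂ[X]) (hST : S * T = 1) (k : ℕ) :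
    minorIdeal (Matrix.fromBlocks M 0 N S) (k + Fintype.card s) = minorIdeal M k := by
  rw [← minorIdeal_fromBlocks_one (s := s) M]
  apply le_antisymm
  · have h : Matrix.fromBlocks M 0 N S =
        Matrix.fromBlocks M 0 0 (1 : Matrix s s ℂ[X]) * Matrix.fromBlocks (1 : Matrix r r ℂ[X]) 0 N S := by
      simp [Matrix.fromBlocks_multiply]
    rw [h]
    exact minorIdeal_mul_le_left _ _ _
  -- The right factor uses `T` to turn `S` into the identity and to clear `N`.
  · have h : Matrix.fromBlocks M 0 0 (1 : Matrix s s ℂ[X]) =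
        Matrix.fromBlocks M 0 N S * Matrix.fromBlocks (1 : Matrix r r ℂ[X]) 0 (-(T * N)) T := by
      simp [Matrix.fromBlocks_multiply, ← Matrix.mul_assoc, hST]
    rw [h]
    exact minorIdeal_mul_le_left _ _ _

/-- A polynomial matrix whose maximal minors generate the unit ideal is right invertible. -/
theorem exists_mul_eq_one_of_minorIdeal_eq_top [Fintype s] [DecidableEq s] [Fintype q]
    (S : Matrix s q ℂ[X]) (h : minorIdeal S (Fintype.card s) = ⊤) :
    ∃ T : Matrix q s ℂ[X], S * T = 1 := by
  classical
  -- The scalars `c` for which `c • 1` factors through `S`. Each maximal minor is one: select its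
  -- columns and multiply by the adjugate.
  let I : Ideal ℂ[X] :=
    { carrier := {c | ∃ T : Matrix q s ℂ[X], S * T = c • (1 : Matrix s s ℂ[X])}
      add_mem' := by
        rintro a b ⟨T, hT⟩ ⟨T', hT'⟩
        exact ⟨T + T', by rw [Matrix.mul_add, hT, hT', add_smul]⟩
      zero_mem' := ⟨0, by simp⟩
      smul_mem' := by
        rintro c a ⟨T, hT⟩
        exact ⟨c • T, by rw [Matrix.mul_smul, hT, smul_smul, smul_eq_mul]⟩ }
  have hle : minorIdeal S (Fintype.card s) ≤ I := by
    refine Ideal.span_le.2 ?_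
    rintro p ⟨f, g, rfl⟩
    by_cases hf : Function.Injective f
    · have hf' : Function.Bijective f :=
        (Fintype.bijective_iff_injective_and_card f).2 ⟨hf, by simp⟩
      let e := Equiv.ofBijective f hf'
      have h1 : S.submatrix f g = (S.submatrix id (g ∘ e.symm)).submatrix e e := by
        ext i j
        simp [e]
      rw [h1, Matrix.det_submatrix_equiv_self]
      refine ⟨(1 : Matrix q q ℂ[X]).submatrix id (g ∘ e.symm) *
        (S.submatrix id (g ∘ e.symm)).adjugate, ?_⟩
      rw [← Matrix.mul_assoc, ← Matrix.mul_adjugate]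
      congr 1
      ext i j
      simp [Matrix.mul_apply, Matrix.one_apply]
    · rw [det_submatrix_eq_zero_of_not_injective _ _ _ hf]
      exact I.zero_mem
  have h1 : (1 : ℂ[X]) ∈ I := hle (h ▸ Submodule.mem_top)
  obtain ⟨T, hT⟩ := h1
  exact ⟨T, by rw [hT, one_smul]⟩

end Minors

/-! ### Elementary divisors read off from determinantal ideals. -/

section Exponents

variable {m n p q : Type}

theorem normalRank_eq (M : Matrix m n ℂ[X]) (N : ℕ)
    (h : ∀ k, minorIdeal M k ≠ ⊥ ↔ k ≤ N) : normalRank M = N := by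
  unfold normalRank
  simp only [h]
  exact csSup_Iic

theorem normalRank_eq_card [Fintype m] (M : Matrix m n ℂ[X])
    (h : minorIdeal M (Fintype.card m) ≠ ⊥) : normalRank M = Fintype.card m := by
  refine normalRank_eq M _ fun k => ⟨fun hk => ?_, fun hk hb => h ?_⟩
  · by_contra hlt
    exact hk (minorIdeal_eq_bot_of_card_lt M (not_le.1 hlt))
  · exact eq_bot_iff.2 (hb ▸ minorIdeal_antitone M hk)

theorem detDivisor_eq_of_minorIdeal_eq (M : Matrix m n ℂ[X]) (N : Matrix p q ℂ[X]) {j k : ℕ}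
    (h : minorIdeal M j = minorIdeal N k) : detDivisor M j = detDivisor N k := by
  unfold detDivisor
  congr 1

theorem span_detDivisor (M : Matrix m n ℂ[X]) (k : ℕ) :
    Ideal.span {detDivisor M k} = minorIdeal M k :=
  Ideal.span_singleton_generator _

theorem isUnit_detDivisor (M : Matrix m n ℂ[X]) {k : ℕ} (h : minorIdeal M k = ⊤) :
    IsUnit (detDivisor M k) := by
  rw [← Ideal.span_singleton_eq_top, span_detDivisor, h]

theorem rootMultiplicity_eq_zero_of_isUnit {f : ℂ[X]} (h : IsUnit f) (a : ℂ) :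
    f.rootMultiplicity a = 0 := by
  apply rootMultiplicity_eq_zero
  intro hr
  exact not_isUnit_X_sub_C a (isUnit_of_dvd_unit (dvd_iff_isRoot.2 hr) h)

theorem elementaryExponents_eq_of_minorIdeal_eq (M : Matrix m n ℂ[X]) (N : Matrix p q ℂ[X])
    (h : ∀ k, minorIdeal M k = minorIdeal N k) (a : ℂ) :
    elementaryExponents M a = elementaryExponents N a := by
  have hd : ∀ k, detDivisor M k = detDivisor N k :=
    fun k => detDivisor_eq_of_minorIdeal_eq M N (h k)
  simp only [elementaryExponents, normalRank, h, hd]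

/-- The divisors of `M` up to index `s` are units, so they contribute only zeros, which the filter
discards; the later ones are those of `N`. -/
theorem elementaryExponents_eq_of_minorIdeal_add (M : Matrix m n ℂ[X]) (N : Matrix p q ℂ[X])
    (s R : ℕ) (h : ∀ k, minorIdeal M (k + s) = minorIdeal N k)
    (hR : ∀ k, minorIdeal N k ≠ ⊥ ↔ k ≤ R) (a : ℂ) :
    elementaryExponents M a = elementaryExponents N a := by
  have htop : ∀ k ≤ s, minorIdeal M k = ⊤ := fun k hk => by
    have := minorIdeal_antitone M hk
    rwa [← zero_add s, h 0, minorIdeal_zero, top_le_iff] at this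
  have hM : normalRank M = s + R := by
    refine normalRank_eq M _ fun k => ?_
    rcases le_total k s with hk | hk
    · rw [htop k hk]
      simp [hk.trans (Nat.le_add_right s R)]
    · obtain ⟨j, rfl⟩ := Nat.exists_eq_add_of_le' hk
      rw [h, hR]
      omega
  have hd : ∀ k, detDivisor M (k + s) = detDivisor N k :=
    fun k => detDivisor_eq_of_minorIdeal_eq M N (h k)
  unfold elementaryExponents
  rw [hM, normalRank_eq N R hR, Multiset.range_add, Multiset.map_add, Multiset.filter_add,
    Multiset.map_map]
  have h1 : ((Multiset.range s).map fun k => (detDivisor M (k + 1)).rootMultiplicity a -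
      (detDivisor M k).rootMultiplicity a).filter (· ≠ 0) = 0 := by
    rw [Multiset.filter_eq_nil]
    intro x hx
    obtain ⟨k, hk, rfl⟩ := Multiset.mem_map.1 hx
    rw [rootMultiplicity_eq_zero_of_isUnit
      (isUnit_detDivisor M (htop (k + 1) (Multiset.mem_range.1 hk)))]
    simp
  rw [h1, zero_add]
  congr 1
  refine Multiset.map_congr rfl fun k _ => ?_
  simp only [Function.comp]
  rw [← hd, ← hd, add_comm s k, add_right_comm k s 1]

/-- The exponents at a point add up to the multiplicity of the last determinantal divisor. -/
theorem sum_elementaryExponents (M : Matrix m n ℂ[X]) (R : ℕ) (hN : normalRank M = R)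
    (hR : minorIdeal M R ≠ ⊥) (a : ℂ) :
    (elementaryExponents M a).sum = (detDivisor M R).rootMultiplicity a := by
  have hne : ∀ k ≤ R, detDivisor M k ≠ 0 := fun k hk h0 => by
    apply hR
    rw [eq_bot_iff, ← Ideal.span_singleton_eq_bot.2 h0, span_detDivisor]
    exact minorIdeal_antitone M hk
  have hf : ∀ t : Multiset ℕ, (t.filter (· ≠ 0)).sum = t.sum := fun t => by
    induction t using Multiset.induction_on with
    | empty => simp
    | cons x t ih =>
      by_cases hx : x = 0
      · simp [hx, ih]
      · simp [hx, ih]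
  unfold elementaryExponents
  rw [hf, hN]
  -- The sum telescopes; divisibility of successive divisors keeps the natural subtraction from
  -- truncating.
  have hsum : ∀ K ≤ R, ((Multiset.range K).map fun k => (detDivisor M (k + 1)).rootMultiplicity a -
      (detDivisor M k).rootMultiplicity a).sum = (detDivisor M K).rootMultiplicity a := by
    intro K
    induction K with
    | zero =>
      intro _
      simp [rootMultiplicity_eq_zero_of_isUnit (isUnit_detDivisor M (minorIdeal_zero M))]
    | succ K ih =>
      intro hK
      rw [Multiset.range_succ, Multiset.map_cons, Multiset.sum_cons, ih (by omega)]
      have := rootMultiplicity_le_rootMultiplicity_of_dvd (hne _ hK) (detDivisor_dvd_succ M K) a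
      omega
  exact hsum R le_rfl

/-- The exponents vanish exactly when their sum does, that is, when `a` is not a root of the gcd of
the minors of size `R`. -/
theorem elementaryExponents_eq_zero_iff (M : Matrix m n ℂ[X]) (R : ℕ) (hN : normalRank M = R)
    (hR : minorIdeal M R ≠ ⊥) (a : ℂ) :
    elementaryExponents M a = 0 ↔ ∃ (f : Fin R → m) (g : Fin R → n),
      (M.submatrix f g).det.eval a ≠ 0 := by
  have hne : detDivisor M R ≠ 0 := fun h0 => by
    apply hR
    rw [← span_detDivisor, h0, Ideal.span_singleton_eq_bot]
  have h1 : elementaryExponents M a = 0 ↔ (elementaryExponents M a).sum = 0 := by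
    refine ⟨fun h => by simp [h], fun h => ?_⟩
    refine Multiset.eq_zero_of_forall_notMem fun x hx => ?_
    have h0 := (Multiset.sum_eq_zero_iff.1 h) x hx
    exact (Multiset.mem_filter.1 hx).2 h0
  rw [h1, sum_elementaryExponents M R hN hR]
  constructor
  · intro h
    by_contra! hall
    have hle : minorIdeal M R ≤ Ideal.span {X - C a} := by
      refine Ideal.span_le.2 ?_
      rintro p ⟨f, g, rfl⟩
      exact Ideal.mem_span_singleton.2 (dvd_iff_isRoot.2 (hall f g))
    rw [← span_detDivisor, Ideal.span_singleton_le_span_singleton, dvd_iff_isRoot] at hle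
    exact absurd h ((rootMultiplicity_pos hne).2 hle).ne'
  · rintro ⟨f, g, hfg⟩
    apply rootMultiplicity_eq_zero
    intro hr
    have hdvd : detDivisor M R ∣ (M.submatrix f g).det := by
      rw [← Ideal.mem_span_singleton, span_detDivisor]
      exact det_submatrix_mem_minorIdeal M f g
    exact hfg (IsRoot.dvd hr hdvd)

end Exponents

/-! ### Elementary divisors and the rank at single points. -/

section Pointwise

/-- Row rank equals column rank, so the columns contain a basis of the column space with as many
members as there are rows. -/
theorem exists_det_submatrix_ne_zero {K m n : Type} [Field K] [Fintype m] [DecidableEq m]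
    [Fintype n] (N : Matrix m n K) (h : ∀ v, Matrix.vecMul v N = 0 → v = 0) :
    ∃ g : m → n, (N.submatrix id g).det ≠ 0 := by
  have hli : LinearIndependent K N.row := by
    rw [← Matrix.vecMul_injective_iff]
    intro v w hvw
    rw [← sub_eq_zero]
    apply h
    rw [Matrix.sub_vecMul]
    exact sub_eq_zero.2 hvw
  have hr := hli.rank_matrix
  rw [Matrix.rank_eq_finrank_span_cols] at hr
  obtain ⟨f, hf, -, hfi⟩ := Submodule.exists_fun_fin_finrank_span_eq K (Set.range N.col)
  choose g hg using hf
  let e : m ≃ Fin (Module.finrank K (Submodule.span K (Set.range N.col))) :=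
    (Fintype.equivFin m).trans (finCongr hr.symm)
  refine ⟨g ∘ e, ?_⟩
  have hc : LinearIndependent K (N.submatrix id (g ∘ e)).col := by
    have : (N.submatrix id (g ∘ e)).col = f ∘ e := by
      ext i j
      rw [Function.comp, ← hg]
      rfl
    rw [this]
    exact hfi.comp e e.injective
  exact ((Matrix.isUnit_iff_isUnit_det _).1 (Matrix.linearIndependent_cols_iff_isUnit.1 hc)).ne_zero

variable {m n : Type}

theorem eval_det_submatrix (M : Matrix m n ℂ[X]) (a : ℂ) {k : ℕ} (f : Fin k → m) (g : Fin k → n) :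
    (M.submatrix f g).det.eval a = ((M.map (eval a)).submatrix f g).det := by
  rw [← coe_evalRingHom, RingHom.map_det]
  rfl

theorem exists_eval_det_submatrix_ne_zero [Fintype m] [Fintype n]
    (M : Matrix m n ℂ[X]) (a : ℂ) (h : ∀ v, Matrix.vecMul v (M.map (eval a)) = 0 → v = 0) :
    ∃ (f : Fin (Fintype.card m) → m) (g : Fin (Fintype.card m) → n),
      (M.submatrix f g).det.eval a ≠ 0 := by
  classical
  obtain ⟨g, hg⟩ := exists_det_submatrix_ne_zero _ h
  refine ⟨(Fintype.equivFin m).symm, g ∘ (Fintype.equivFin m).symm, ?_⟩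
  rw [eval_det_submatrix]
  have := Matrix.det_submatrix_equiv_self (Fintype.equivFin m).symm
    ((M.map (eval a)).submatrix id g)
  rw [Matrix.submatrix_submatrix] at this
  exact (this.trans_ne hg)

theorem minorIdeal_ne_bot_of_eval_ne_zero (M : Matrix m n ℂ[X]) (a : ℂ) {k : ℕ} (f : Fin k → m)
    (g : Fin k → n) (h : (M.submatrix f g).det.eval a ≠ 0) : minorIdeal M k ≠ ⊥ := by
  intro hb
  have := det_submatrix_mem_minorIdeal M f g
  rw [hb, Submodule.mem_bot] at this
  exact h (by rw [this, eval_zero])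

theorem elementaryExponents_eq_zero_of_vecMul [Fintype m] [Fintype n] (M : Matrix m n ℂ[X]) (a : ℂ)
    (h : ∀ v, Matrix.vecMul v (M.map (eval a)) = 0 → v = 0) : elementaryExponents M a = 0 := by
  obtain ⟨f, g, hfg⟩ := exists_eval_det_submatrix_ne_zero M a h
  have hb := minorIdeal_ne_bot_of_eval_ne_zero M a f g hfg
  exact (elementaryExponents_eq_zero_iff M _ (normalRank_eq_card M hb) hb a).2 ⟨f, g, hfg⟩

/-- If the gcd of the maximal minors were not a unit, it would have a complex root, and the rank
would drop there. -/
theorem minorIdeal_card_eq_top [Fintype m] [Fintype n] (M : Matrix m n ℂ[X])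
    (h : ∀ a v, Matrix.vecMul v (M.map (eval a)) = 0 → v = 0) :
    minorIdeal M (Fintype.card m) = ⊤ := by
  by_contra hne
  have hroot : ∃ a, detDivisor M (Fintype.card m) ∈ Ideal.span {X - C a} := by
    have hu : ¬ IsUnit (detDivisor M (Fintype.card m)) := by
      rwa [← Ideal.span_singleton_eq_top, span_detDivisor]
    have hd : (detDivisor M (Fintype.card m)).degree ≠ 0 := by
      intro hd
      exact hu (isUnit_iff_degree_eq_zero.2 hd)
    obtain ⟨a, ha⟩ := IsAlgClosed.exists_root _ hd
    exact ⟨a, Ideal.mem_span_singleton.2 (dvd_iff_isRoot.2 ha)⟩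
  obtain ⟨a, ha⟩ := hroot
  obtain ⟨f, g, hfg⟩ := exists_eval_det_submatrix_ne_zero M a (h a)
  have hm := det_submatrix_mem_minorIdeal M f g
  rw [← span_detDivisor] at hm
  have := (Ideal.span_singleton_le_iff_mem _).2 ha hm
  rw [Ideal.mem_span_singleton, dvd_iff_isRoot] at this
  exact hfg this

theorem elementaryExponents_transpose (M : Matrix m n ℂ[X]) (a : ℂ) :
    elementaryExponents M.transpose a = elementaryExponents M a :=
  elementaryExponents_eq_of_minorIdeal_eq _ _ (minorIdeal_transpose M) a

theorem elementaryExponents_eq_zero_of_mulVec [Fintype m] [Fintype n] (M : Matrix m n ℂ[X]) (a : ℂ)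
    (h : ∀ v, Matrix.mulVec (M.map (eval a)) v = 0 → v = 0) : elementaryExponents M a = 0 := by
  rw [← elementaryExponents_transpose]
  refine elementaryExponents_eq_zero_of_vecMul _ _ fun v hv => h v ?_
  rwa [Matrix.transpose_map, Matrix.vecMul_transpose] at hv

/-- The assumption `hb` is full column normal rank. Without it, an empty list of exponents would not
exclude a kernel. -/
theorem eq_zero_of_mulVec_of_elementaryExponents [Fintype n] (M : Matrix m n ℂ[X]) (a : ℂ)
    (hb : minorIdeal M (Fintype.card n) ≠ ⊥) (h : elementaryExponents M a = 0) (v : n → ℂ)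
    (hv : Matrix.mulVec (M.map (eval a)) v = 0) : v = 0 := by
  classical
  have hb' := hb
  rw [← minorIdeal_transpose] at hb'
  rw [← elementaryExponents_transpose,
    elementaryExponents_eq_zero_iff _ _ (normalRank_eq_card _ hb') hb'] at h
  obtain ⟨g, f, hfg⟩ := h
  rw [← Matrix.transpose_submatrix, Matrix.det_transpose] at hfg
  have hg : Function.Injective g := by
    by_contra hg
    apply hfg
    rw [← Matrix.det_transpose, Matrix.transpose_submatrix,
      det_submatrix_eq_zero_of_not_injective _ _ _ hg, eval_zero]
  have hg' : Function.Bijective g :=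
    (Fintype.bijective_iff_injective_and_card g).2 ⟨hg, by simp⟩
  rw [eval_det_submatrix] at hfg
  have h0 : v ∘ g = 0 := by
    by_contra hne
    apply hfg
    refine Matrix.exists_mulVec_eq_zero_iff.1 ⟨v ∘ g, hne, ?_⟩
    ext i
    have := congrFun hv (f i)
    simp only [Matrix.mulVec, dotProduct, Pi.zero_apply, Matrix.submatrix_apply,
      Function.comp] at this ⊢
    rw [← this]
    exact (Function.Bijective.sum_comp hg' (fun j => M.map (eval a) (f i) j * v j))
  ext j
  obtain ⟨i, rfl⟩ := hg'.2 j
  exact congrFun h0 i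

end Pointwise

/-! ### Reversal, and the eigenvalue count of a regular pencil. -/

namespace Pencil

variable {m n : Type}

theorem poly_map_eval (P : Pencil m n) (a : ℂ) :
    P.poly.map (eval a) = a • P.lead - P.const := by
  ext i j
  simp [poly]
  ring

theorem rev_map_eval (P : Pencil m n) (a : ℂ) :
    P.rev.map (eval a) = P.lead - a • P.const := by
  ext i j
  simp [rev]
  ring

/-- For `a ≠ 0` the reversed pencil at `a` is `a` times the pencil at `a⁻¹`; agreement at infinitely
many points suffices. -/
theorem det_rev_eq_reflect [Fintype n] [DecidableEq n] (P : Pencil n n) :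
    P.rev.det = reflect (Fintype.card n) P.poly.det := by
  have hdeg : P.poly.det.natDegree ≤ Fintype.card n := by
    have := natDegree_det_X_add_C_le P.lead (-P.const)
    rwa [show (X : ℂ[X]) • P.lead.map C + (-P.const).map C = P.poly by
      ext i j; simp [poly, sub_eq_add_neg]] at this
  refine eq_of_infinite_eval_eq _ _ ?_
  refine Set.Infinite.mono (s := {0}ᶜ) ?_ (Set.Finite.infinite_compl (Set.finite_singleton _))
  intro a ha
  have ha : a ≠ 0 := ha
  let _ := invertibleOfNonzero (inv_ne_zero ha)
  have h := eval₂_reflect_mul_pow (RingHom.id ℂ) a⁻¹ (Fintype.card n) P.poly.det hdeg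
  simp only [invOf_eq_inv, inv_inv] at h
  change eval a _ * _ = eval a⁻¹ _ at h
  change eval a _ = eval a _
  rw [eq_comm, ← mul_left_inj' (pow_ne_zero (Fintype.card n) (inv_ne_zero ha)), h]
  have e1 : ∀ (Q : Matrix n n ℂ[X]) (b : ℂ), eval b Q.det = (Q.map (eval b)).det := fun Q b => by
    rw [← coe_evalRingHom, RingHom.map_det]; rfl
  rw [e1, e1, poly_map_eval, rev_map_eval, mul_comm, ← Matrix.det_smul]
  congr 1
  rw [smul_sub, smul_smul, inv_mul_cancel₀ ha, one_smul]

theorem IsRegular.det_rev_ne_zero [Fintype n] [DecidableEq n] {P : Pencil n n} (h : P.IsRegular) :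
    P.rev.det ≠ 0 := by
  rw [det_rev_eq_reflect]
  exact fun h0 => h (reflect_eq_zero_iff.1 h0)

theorem sum_elementaryExponents_of_det_ne_zero [Fintype n] [DecidableEq n] (M : Matrix n n ℂ[X])
    (h : M.det ≠ 0) (a : ℂ) : (elementaryExponents M a).sum = M.det.rootMultiplicity a := by
  have hb : minorIdeal M (Fintype.card n) ≠ ⊥ := by
    rw [minorIdeal_card]
    simpa using h
  rw [sum_elementaryExponents M _ (normalRank_eq_card M hb) hb]
  have h1 : Ideal.span {detDivisor M (Fintype.card n)} = Ideal.span {M.det} := by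
    rw [span_detDivisor, minorIdeal_card]
  rw [Ideal.span_singleton_eq_span_singleton] at h1
  have h2 : detDivisor M (Fintype.card n) ≠ 0 := fun h0 => h (h1.eq_zero_iff.1 h0)
  exact le_antisymm (rootMultiplicity_le_rootMultiplicity_of_dvd h h1.dvd a)
    (rootMultiplicity_le_rootMultiplicity_of_dvd h2 h1.symm.dvd a)

/-- A regular pencil has as many eigenvalues as its size. -/
theorem IsRegular.numEigenvalues_eq [Fintype n] [DecidableEq n] {P : Pencil n n}
    (h : P.IsRegular) : P.numEigenvalues = Fintype.card n := by
  have hdeg : P.poly.det.natDegree ≤ Fintype.card n := by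
    have := natDegree_det_X_add_C_le P.lead (-P.const)
    rwa [show (X : ℂ[X]) • P.lead.map C + (-P.const).map C = P.poly by
      ext i j; simp [poly, sub_eq_add_neg]] at this
  have hfin : ∀ a : ℂ, (P.blockSizes a).sum = P.poly.det.roots.count a := fun a => by
    rw [count_roots]
    exact sum_elementaryExponents_of_det_ne_zero _ h a
  -- Reflection turns the degree deficit of the determinant into the order of its zero at `0`. The
  -- finite eigenvalues account for the degree.
  have hinf : (P.blockSizes OnePoint.infty).sum = Fintype.card n - P.poly.det.natDegree := by
    change (elementaryExponents P.rev 0).sum = _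
    rw [sum_elementaryExponents_of_det_ne_zero _ h.det_rev_ne_zero,
      rootMultiplicity_eq_natTrailingDegree', det_rev_eq_reflect]
    have h0 : reflect (Fintype.card n) P.poly.det ≠ 0 := fun h0 => h (reflect_eq_zero_iff.1 h0)
    apply le_antisymm
    · apply natTrailingDegree_le_of_ne_zero
      rw [coeff_reflect, revAt_le (Nat.sub_le _ _), Nat.sub_sub_self hdeg]
      exact leadingCoeff_ne_zero.2 h
    · refine le_natTrailingDegree h0 fun i hi => ?_
      rw [coeff_reflect, revAt_le (by omega)]
      exact coeff_eq_zero_of_natDegree_lt (by omega)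
  unfold numEigenvalues
  classical
  rw [finsum_eq_sum_of_support_subset (s := insert OnePoint.infty
    (P.poly.det.roots.toFinset.image ((↑) : ℂ → OnePoint ℂ)))]
  · rw [Finset.sum_insert (by simp), Finset.sum_image (fun x _ y _ hxy => OnePoint.coe_injective hxy),
      hinf]
    simp only [hfin]
    rw [Multiset.toFinset_sum_count_eq, splits_iff_card_roots.1 (IsAlgClosed.splits _)]
    omega
  · intro z hz
    induction z using OnePoint.rec with
    | infty => simp
    | coe a =>
      rw [Function.mem_support, hfin, ← Nat.pos_iff_ne_zero, Multiset.count_pos] at hz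
      simp only [Finset.coe_insert, Finset.coe_image]
      exact Set.mem_insert_of_mem _ ⟨a, by simpa using hz, rfl⟩

end Pencil

/-! ### Minimal deflating pairs of subspaces. -/

section DeflatingSubspaces

open Module

/-- Pulling back along an injection does not raise the codimension. This provides the room for the
prescribed columns of `V` and `W`. -/
theorem finrank_add_finrank_le_comap_add {K E F : Type*} [Field K] [AddCommGroup E] [Module K E]
    [AddCommGroup F] [Module K F] [FiniteDimensional K E] [FiniteDimensional K F]
    (f : E →ₗ[K] F) (hf : Function.Injective f) (S : Submodule K F) :
    finrank K S + finrank K E ≤ finrank K (S.comap f) + finrank K F := by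
  have h1 := Submodule.finrank_sup_add_finrank_inf_eq S (LinearMap.range f)
  have h2 := Submodule.finrank_le (S ⊔ LinearMap.range f)
  have h3 := LinearMap.finrank_range_of_inj hf
  have h4 : finrank K (S.comap f) = finrank K (S ⊓ LinearMap.range f : Submodule K F) := by
    rw [(Submodule.equivMapOfInjective f hf (S.comap f)).finrank_eq, Submodule.map_comap_eq,
      inf_comm]
  omega

theorem finrank_le_finrank_inf_ker_add_one {K E : Type*} [Field K] [AddCommGroup E] [Module K E]
    [FiniteDimensional K E] (f : E →ₗ[K] K) (S : Submodule K E) :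
    finrank K S ≤ finrank K (S ⊓ LinearMap.ker f : Submodule K E) + 1 := by
  have h1 := Submodule.finrank_sup_add_finrank_inf_eq S (LinearMap.ker f)
  have h2 := Submodule.finrank_le (S ⊔ LinearMap.ker f)
  have h3 := LinearMap.finrank_range_add_finrank_ker f
  have h4 := Submodule.finrank_le (LinearMap.range f)
  rw [finrank_self] at h4
  omega

/-- A pencil `α • φ - β • ψ` that is surjective somewhere has a pair of subspaces `S`, `L`, of the
same index as the whole spaces, such that it maps `S` onto `L` at all points. -/
theorem exists_deflating_pair {K E F : Type*} [Field K] [AddCommGroup E] [Module K E]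
    [AddCommGroup F] [Module K F] [FiniteDimensional K E] [FiniteDimensional K F]
    (φ ψ : E →ₗ[K] F) (n : ℕ) (hn : finrank K E = finrank K F + n)
    (hsurj : ∃ α β : K, Function.Surjective (α • φ - β • ψ)) :
    ∃ (S : Submodule K E) (L : Submodule K F), (∀ x ∈ S, φ x ∈ L) ∧ (∀ x ∈ S, ψ x ∈ L) ∧
      finrank K S = finrank K L + n ∧
      ∀ α β : K, (α ≠ 0 ∨ β ≠ 0) → L ≤ S.map (α • φ - β • ψ) := by
  classical
  -- The dimension of `L` is minimised under the inequality only; equality is recovered afterwards.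
  have hex : ∃ s, ∃ (S : Submodule K E) (L : Submodule K F), (∀ x ∈ S, φ x ∈ L) ∧
      (∀ x ∈ S, ψ x ∈ L) ∧ finrank K L + n ≤ finrank K S ∧ finrank K L = s :=
    ⟨_, ⊤, ⊤, by simp, by simp, by simp [hn], rfl⟩
  obtain ⟨S, L, hφ, hψ, hd, hs⟩ := Nat.find_spec hex
  refine ⟨S, L, hφ, hψ, le_antisymm ?_ hd, ?_⟩
  -- At a point of surjectivity the kernel has dimension `n`, so `S` exceeds `L` by at most `n`.
  · obtain ⟨α, β, hT⟩ := hsurj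
    set T := α • φ - β • ψ with hTdef
    have h1 := LinearMap.finrank_range_add_finrank_ker T
    rw [LinearMap.range_eq_top.2 hT, finrank_top] at h1
    have h2 := LinearMap.finrank_range_add_finrank_ker (T.domRestrict S)
    have h3 : finrank K (LinearMap.range (T.domRestrict S)) ≤ finrank K L := by
      refine Submodule.finrank_mono ?_
      rintro _ ⟨x, rfl⟩
      exact L.sub_mem (L.smul_mem _ (hφ _ x.2)) (L.smul_mem _ (hψ _ x.2))
    have h4 : finrank K (LinearMap.ker (T.domRestrict S)) ≤ finrank K (LinearMap.ker T) := by
      rw [(Submodule.equivMapOfInjective S.subtype S.injective_subtype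
        (LinearMap.ker (T.domRestrict S))).finrank_eq]
      refine Submodule.finrank_mono ?_
      rintro _ ⟨x, hx, rfl⟩
      exact hx
    omega
  · intro α β hαβ
    by_contra hnot
    obtain ⟨y, hyL, hy⟩ := SetLike.not_le_iff_exists.1 hnot
    obtain ⟨f, hfy, hf⟩ := Submodule.exists_le_ker_of_notMem hy
    have hfT : ∀ x ∈ S, α * f (φ x) = β * f (ψ x) := fun x hx => by
      have := hf (Submodule.mem_map_of_mem hx)
      rw [LinearMap.mem_ker] at this
      simpa [sub_eq_zero] using this
    -- On `S` the functionals `f ∘ φ` and `f ∘ ψ` are proportional, so the one with the possibly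
    -- vanishing coefficient controls both. Cutting with `ker g` costs `S` at most one dimension,
    -- while `ker f` costs `L` at least one.
    obtain ⟨g, hg1, hg2⟩ : ∃ g : E →ₗ[K] K, (∀ x ∈ S, g x = 0 → f (φ x) = 0) ∧
        (∀ x ∈ S, g x = 0 → f (ψ x) = 0) := by
      rcases hαβ with h | h
      · refine ⟨f ∘ₗ ψ, fun x hx h0 => ?_, fun x hx h0 => h0⟩
        have h1 := hfT x hx
        rw [show f (ψ x) = 0 from h0, mul_zero] at h1
        exact (mul_eq_zero.1 h1).resolve_left h
      · refine ⟨f ∘ₗ φ, fun x hx h0 => h0, fun x hx h0 => ?_⟩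
        have h1 := hfT x hx
        rw [show f (φ x) = 0 from h0, mul_zero] at h1
        exact (mul_eq_zero.1 h1.symm).resolve_left h
    have hlt : finrank K (L ⊓ LinearMap.ker f : Submodule K F) < finrank K L := by
      refine Submodule.finrank_lt_finrank_of_lt (lt_of_le_of_ne inf_le_left fun h => hfy ?_)
      rw [← h] at hyL
      exact hyL.2
    refine Nat.find_min hex (hs ▸ hlt) ⟨S ⊓ LinearMap.ker g, L ⊓ LinearMap.ker f,
      fun x hx => ⟨hφ x hx.1, hg1 x hx.1 hx.2⟩, fun x hx => ⟨hψ x hx.1, hg2 x hx.1 hx.2⟩, ?_, rfl⟩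
    have := finrank_le_finrank_inf_ker_add_one g S
    omega

end DeflatingSubspaces

/-! ### Unitary matrices adapted to a subspace. -/

section Unitary

open Module Matrix

variable {ι τ σ : Type} [Fintype ι] [Fintype τ] [DecidableEq τ] [Fintype σ]

/-- There is a unitary matrix with prescribed columns in a given subspace. -/
theorem exists_unitary_col_mem [DecidableEq ι] (S : Submodule ℂ (ι → ℂ)) (hc : Fintype.card ι = Fintype.card τ)
    (g : σ → τ) (hg : Function.Injective g) (hS : Fintype.card σ ≤ finrank ℂ S) :
    ∃ Q : Matrix ι τ ℂ, Qᴴ * Q = 1 ∧ Q * Qᴴ = 1 ∧ ∀ j, Q.col (g j) ∈ S := by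
  classical
  let S' : Submodule ℂ (EuclideanSpace ℂ ι) :=
    S.comap (WithLp.linearEquiv 2 ℂ (ι → ℂ)).toLinearMap
  have hfin : finrank ℂ S' = finrank ℂ S := by
    have h : S' = S.map (WithLp.linearEquiv 2 ℂ (ι → ℂ)).symm.toLinearMap :=
      Submodule.comap_equiv_eq_map_symm _ _
    rw [h]
    exact LinearEquiv.finrank_map_eq _ S
  let b₀ := stdOrthonormalBasis ℂ S'
  let u : σ → Fin (finrank ℂ S') := fun j =>
    Fin.castLE (hS.trans hfin.ge) (Fintype.equivFin σ j)
  have hu : Function.Injective u :=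
    (Fin.castLE_injective _).comp (Fintype.equivFin σ).injective
  -- The value `0` off the range of `g` is immaterial: only the restriction to that range is
  -- extended to an orthonormal basis.
  let v : τ → EuclideanSpace ℂ ι := Function.extend g (fun j => (b₀ (u j) : EuclideanSpace ℂ ι)) 0
  have hv : ∀ j, v (g j) = b₀ (u j) := fun j => hg.extend_apply _ _ j
  have horth : Orthonormal ℂ ((Set.range g).domRestrict v) := by
    rw [orthonormal_iff_ite]
    rintro ⟨_, i, rfl⟩ ⟨_, j, rfl⟩
    simp only [Set.domRestrict_apply, hv]
    rw [← Submodule.coe_inner, (orthonormal_iff_ite.1 b₀.orthonormal)]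
    by_cases h : i = j
    · subst h
      simp
    · rw [if_neg (hu.ne h), if_neg fun h' => h (hg (congrArg Subtype.val h'))]
  obtain ⟨b, hb⟩ := horth.exists_orthonormalBasis_extension_of_card_eq
    (by rw [finrank_euclideanSpace, hc])
  have hQ : (Matrix.of fun i j => b j i : Matrix ι τ ℂ)ᴴ * (Matrix.of fun i j => b j i) = 1 := by
    ext i j
    have := orthonormal_iff_ite.1 b.orthonormal i j
    rw [PiLp.inner_apply] at this
    simp only [mul_apply, conjTranspose_apply, of_apply, one_apply]
    rw [← this]
    refine Finset.sum_congr rfl fun k _ => ?_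
    simp [mul_comm]
  refine ⟨_, hQ, (mul_eq_one_comm_of_card_eq _ _ _ hc).2 hQ, fun j => ?_⟩
  have h1 : b (g j) ∈ S' := by
    rw [hb _ ⟨j, rfl⟩, hv]
    exact (b₀ (u j)).2
  exact h1

theorem mulVec_eq_zero_of_conjTranspose_mul {Q : Matrix ι τ ℂ} (hQ : Qᴴ * Q = 1) {x : τ → ℂ}
    (hx : Q *ᵥ x = 0) : x = 0 := by
  have := congrArg (Qᴴ *ᵥ ·) hx
  simpa [hQ] using this

theorem finrank_range_mulVecLin {Q : Matrix ι τ ℂ} (hQ : Qᴴ * Q = 1) :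
    finrank ℂ (LinearMap.range Q.mulVecLin) = Fintype.card τ := by
  rw [LinearMap.finrank_range_of_inj, finrank_fintype_fun_eq_card]
  exact (injective_iff_map_eq_zero Q.mulVecLin).2
    fun x hx => mulVec_eq_zero_of_conjTranspose_mul hQ hx

theorem exists_mulVec_eq_of_col_mem {Q : Matrix ι τ ℂ} (hQ : Qᴴ * Q = 1)
    (S : Submodule ℂ (ι → ℂ)) (hS : finrank ℂ S = Fintype.card τ) (hmem : ∀ j, Q.col j ∈ S)
    {y : ι → ℂ} (hy : y ∈ S) : ∃ z, Q *ᵥ z = y := by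
  have h : LinearMap.range Q.mulVecLin = S := by
    apply Submodule.eq_of_le_of_finrank_eq
    · rw [range_mulVecLin, Submodule.span_le]
      rintro _ ⟨j, rfl⟩
      exact hmem j
    · rw [finrank_range_mulVecLin hQ, hS]
  rw [← h] at hy
  exact hy

end Unitary

/-! ### The staircase form. -/

section Staircase

open Module Matrix

variable {δ ρ σ ν : Type} [Fintype δ] [DecidableEq δ] [Fintype ρ] [DecidableEq ρ] [Fintype σ]
  [DecidableEq σ] [Fintype ν] [DecidableEq ν]

/-- The exchange of the last two summands. -/
def sumSwapRight (ρ σ ν : Type) : (ρ ⊕ σ) ⊕ ν ≃ (ρ ⊕ ν) ⊕ σ :=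
  (Equiv.sumAssoc ρ σ ν).trans
    ((Equiv.sumCongr (Equiv.refl ρ) (Equiv.sumComm σ ν)).trans (Equiv.sumAssoc ρ ν σ).symm)

/-- After an exchange of summands, `W` is the direct sum of a small matrix and an identity, and so
inherits unitarity. -/
theorem blockW_eq_submatrix (W₁₁ : Matrix ρ ρ ℂ) (W₁₃ : Matrix ρ ν ℂ) (W₃₁ : Matrix ν ρ ℂ)
    (W₃₃ : Matrix ν ν ℂ) : (blockW W₁₁ W₁₃ W₃₁ W₃₃ : Matrix ((ρ ⊕ σ) ⊕ ν) ((ρ ⊕ σ) ⊕ ν) ℂ) =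
      (fromBlocks (fromBlocks W₁₁ W₁₃ W₃₁ W₃₃) 0 0 (1 : Matrix σ σ ℂ)).submatrix
        (sumSwapRight ρ σ ν) (sumSwapRight ρ σ ν) := by
  ext ((i | i) | i) ((j | j) | j) <;> simp [blockW, sumSwapRight]

theorem blockW_mem_unitaryGroup {W₁₁ : Matrix ρ ρ ℂ} {W₁₃ : Matrix ρ ν ℂ} {W₃₁ : Matrix ν ρ ℂ}
    {W₃₃ : Matrix ν ν ℂ} (h : fromBlocks W₁₁ W₁₃ W₃₁ W₃₃ ∈ unitaryGroup (ρ ⊕ ν) ℂ) :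
    (blockW W₁₁ W₁₃ W₃₁ W₃₃ : Matrix ((ρ ⊕ σ) ⊕ ν) ((ρ ⊕ σ) ⊕ ν) ℂ) ∈
      unitaryGroup ((ρ ⊕ σ) ⊕ ν) ℂ := by
  rw [mem_unitaryGroup_iff, star_eq_conjTranspose] at h ⊢
  rw [blockW_eq_submatrix, conjTranspose_submatrix, submatrix_mul_equiv,
    fromBlocks_conjTranspose (fromBlocks W₁₁ W₁₃ W₃₁ W₃₃), fromBlocks_multiply]
  simp [h]

theorem toCols_of_conjTranspose_mul {V : Matrix δ (ρ ⊕ σ) ℂ} (hV : Vᴴ * V = 1) :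
    V.toCols₁ᴴ * V.toCols₁ = 1 ∧ V.toCols₁ᴴ * V.toCols₂ = 0 ∧ V.toCols₂ᴴ * V.toCols₁ = 0 ∧
      V.toCols₂ᴴ * V.toCols₂ = 1 := by
  rw [← fromCols_toCols V, conjTranspose_fromCols_eq_fromRows_conjTranspose,
    fromRows_mul_fromCols, ← fromBlocks_one, fromBlocks_inj] at hV
  simpa using hV

/-- Unitary matrices bring a pencil with a deflating pair of subspaces to staircase form. -/
theorem exists_staircase (P₁ P₀ : Matrix δ (δ ⊕ ν) ℂ) (S : Submodule ℂ (δ ⊕ ν → ℂ))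
    (L : Submodule ℂ (δ → ℂ)) (h₁ : ∀ x ∈ S, P₁ *ᵥ x ∈ L) (h₀ : ∀ x ∈ S, P₀ *ᵥ x ∈ L)
    (hL : finrank ℂ L = Fintype.card σ) (hS : finrank ℂ S = Fintype.card σ + Fintype.card ν)
    (hδ : Fintype.card δ = Fintype.card ρ + Fintype.card σ)
    (hsurj : ∀ α β : ℂ, (α ≠ 0 ∨ β ≠ 0) → ∀ y ∈ L, ∃ x ∈ S, (α • P₁ - β • P₀) *ᵥ x = y) :
    ∃ (Q V : Matrix δ (ρ ⊕ σ) ℂ) (W₁₁ : Matrix ρ ρ ℂ) (W₁₃ : Matrix ρ ν ℂ)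
      (W₃₁ : Matrix ν ρ ℂ) (W₃₃ : Matrix ν ν ℂ),
      Qᴴ * Q = 1 ∧ Q * Qᴴ = 1 ∧ Vᴴ * V = 1 ∧ V * Vᴴ = 1 ∧
      fromBlocks W₁₁ W₁₃ W₃₁ W₃₃ ∈ unitaryGroup (ρ ⊕ ν) ℂ ∧
      Q.toCols₁ᴴ * P₁ * fromBlocks V.toCols₂ (V.toCols₁ * W₁₃) 0 W₃₃ = 0 ∧
      Q.toCols₁ᴴ * P₀ * fromBlocks V.toCols₂ (V.toCols₁ * W₁₃) 0 W₃₃ = 0 ∧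
      ∀ α β : ℂ, (α ≠ 0 ∨ β ≠ 0) → ∀ v : σ → ℂ,
        v ᵥ* (Q.toCols₂ᴴ * (α • P₁ - β • P₀) *
          fromBlocks V.toCols₂ (V.toCols₁ * W₁₃) 0 W₃₃) = 0 → v = 0 := by
  have hδ' : Fintype.card δ = Fintype.card (ρ ⊕ σ) := by rw [hδ, Fintype.card_sum]
  obtain ⟨Q, hQ, hQ', hQL⟩ := exists_unitary_col_mem L hδ' (Sum.inr : σ → ρ ⊕ σ)
    Sum.inr_injective hL.ge
  -- The last columns of `V` span directions of `S` with no input component. Since `S` has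
  -- codimension `card ρ`, at least `card δ - card ρ = card σ` dimensions are available.
  obtain ⟨V, hV, hV', hVS⟩ := exists_unitary_col_mem
    (S.comap (fromRows (1 : Matrix δ δ ℂ) (0 : Matrix ν δ ℂ)).mulVecLin) hδ'
    (Sum.inr : σ → ρ ⊕ σ) Sum.inr_injective (by
      have := finrank_add_finrank_le_comap_add
        (fromRows (1 : Matrix δ δ ℂ) (0 : Matrix ν δ ℂ)).mulVecLin
        ((injective_iff_map_eq_zero _).2 fun x hx => mulVec_eq_zero_of_conjTranspose_mul
          (by simp [conjTranspose_fromRows_eq_fromCols_conjTranspose, fromCols_mul_fromRows]) hx) S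
      simp only [finrank_fintype_fun_eq_card, Fintype.card_sum] at this
      omega)
  obtain ⟨hQ11, hQ12, hQ21, hQ22⟩ := toCols_of_conjTranspose_mul hQ
  obtain ⟨hV11, hV12, hV21, hV22⟩ := toCols_of_conjTranspose_mul hV
  -- The same count inside the span of the first columns of `V` and the inputs leaves at least `card
  -- ν` dimensions of `S`.
  obtain ⟨w, hw, hw', hwS⟩ := exists_unitary_col_mem
    (S.comap (fromBlocks V.toCols₁ 0 0 (1 : Matrix ν ν ℂ)).mulVecLin) rfl
    (Sum.inr : ν → ρ ⊕ ν) Sum.inr_injective (by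
      have := finrank_add_finrank_le_comap_add
        (fromBlocks V.toCols₁ 0 0 (1 : Matrix ν ν ℂ)).mulVecLin
        ((injective_iff_map_eq_zero _).2 fun x hx => mulVec_eq_zero_of_conjTranspose_mul
          (by simp [fromBlocks_conjTranspose, fromBlocks_multiply, hV11]) hx) S
      simp only [finrank_fintype_fun_eq_card, Fintype.card_sum] at this
      omega)
  set W₁₁ := w.toBlocks₁₁
  set W₁₃ := w.toBlocks₁₂
  set W₃₁ := w.toBlocks₂₁
  set W₃₃ := w.toBlocks₂₂
  have hwb : w = fromBlocks W₁₁ W₁₃ W₃₁ W₃₃ := (fromBlocks_toBlocks w).symm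
  have hw22 : W₁₃ᴴ * W₁₃ + W₃₃ᴴ * W₃₃ = 1 := by
    rw [hwb, fromBlocks_conjTranspose, fromBlocks_multiply, ← fromBlocks_one,
      fromBlocks_inj] at hw
    exact hw.2.2.2
  -- The columns of `Z` form an orthonormal basis of `S`.
  set Z := fromBlocks V.toCols₂ (V.toCols₁ * W₁₃) 0 W₃₃ with hZ
  have hZZ : Zᴴ * Z = 1 := by
    rw [hZ, fromBlocks_conjTranspose, fromBlocks_multiply, ← fromBlocks_one]
    congr 1
    · simp [hV22]
    · simp [← Matrix.mul_assoc, hV21]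
    · simp [Matrix.mul_assoc, hV12]
    · rw [← hw22, conjTranspose_mul, Matrix.mul_assoc, ← Matrix.mul_assoc _ _ W₁₃, hV11,
        Matrix.one_mul]
  have hZS : ∀ c, Z.col c ∈ S := by
    rintro (c | c)
    · have h := hVS c
      rw [Submodule.mem_comap] at h
      convert h using 1
      ext (i | i) <;> simp [hZ, fromRows_mulVec, toCols₂]
    · have h := hwS c
      rw [Submodule.mem_comap] at h
      convert h using 1
      ext (i | i)
      · simp [hZ, mul_apply, mulVec, dotProduct, W₁₃, toBlocks₁₂]
      · simp [hZ, fromBlocks_mulVec, W₃₃, toBlocks₂₂]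
  -- The columns of `Q.toCols₂` span `L`, and those of `Q.toCols₁` are orthogonal to it.
  have hzero : ∀ P : Matrix δ (δ ⊕ ν) ℂ, (∀ x ∈ S, P *ᵥ x ∈ L) → Q.toCols₁ᴴ * P * Z = 0 := by
    intro P hP
    refine ext_of_mulVec_single fun c => ?_
    obtain ⟨z, hz⟩ := exists_mulVec_eq_of_col_mem hQ22 L hL hQL (hP _ (hZS c))
    rw [← mulVec_mulVec, ← mulVec_mulVec, mulVec_single_one, ← hz, mulVec_mulVec, hQ12,
      zero_mulVec, zero_mulVec]
  refine ⟨Q, V, W₁₁, W₁₃, W₃₁, W₃₃, hQ, hQ', hV, hV', hwb ▸ mem_unitaryGroup_iff.2 hw',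
    hzero _ h₁, hzero _ h₀, fun α β hαβ v hv => ?_⟩
  ext j
  -- Surjectivity onto `L` reaches the `j`-th column of `Q.toCols₂`; pairing `v` with its
  -- coordinates isolates `v j`.
  obtain ⟨x, hx, hxj⟩ := hsurj α β hαβ _ (hQL j)
  obtain ⟨z, rfl⟩ := exists_mulVec_eq_of_col_mem hZZ S (by rw [hS, Fintype.card_sum]) hZS hx
  have h1 : Q.toCols₂ᴴ *ᵥ Q.col (Sum.inr j) = Pi.single j 1 := by
    have : Q.col (Sum.inr j) = Q.toCols₂ *ᵥ Pi.single j 1 := by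
      rw [mulVec_single_one]; rfl
    rw [this, mulVec_mulVec, hQ22, one_mulVec]
  have h2 : v ⬝ᵥ (Q.toCols₂ᴴ * (α • P₁ - β • P₀) * Z) *ᵥ z = 0 := by
    rw [dotProduct_mulVec, hv, zero_dotProduct]
  rw [← mulVec_mulVec, ← mulVec_mulVec, hxj, h1] at h2
  simpa using h2

end Staircase

/-! ### Determinants and transfer functions under block triangularisation. -/

section MatrixIdentities

open Matrix

variable {δ ρ σ ν μ : Type} [Fintype δ] [DecidableEq δ] [Fintype ρ] [DecidableEq ρ] [Fintype σ]
  [DecidableEq σ] [Fintype ν]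

/-- Take determinants on both sides; `e` makes the factors `v` and `q` square over `δ`. -/
theorem det_ne_zero_of_mul_eq_mul_fromBlocks {R : Type} [CommRing R] [IsDomain R] (e : δ ≃ ρ ⊕ σ)
    {a : Matrix δ δ R} {v q : Matrix δ (ρ ⊕ σ) R} {v' : Matrix (ρ ⊕ σ) δ R} (hv : v * v' = 1)
    {x : Matrix ρ ρ R} {y : Matrix σ ρ R} {s : Matrix σ σ R}
    (h : a * v = q * fromBlocks x 0 y s) (ha : a.det ≠ 0) : x.det ≠ 0 ∧ s.det ≠ 0 := by
  have h1 : a * v.submatrix id e = q.submatrix id e * (fromBlocks x 0 y s).submatrix e e := by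
    rw [submatrix_mul_equiv, ← h]
    rfl
  have h2 : v.submatrix id e * v'.submatrix e id = 1 := by
    rw [submatrix_mul_equiv, hv, submatrix_id_id]
  have h3 : (v.submatrix id e).det ≠ 0 := by
    intro h0
    have := congrArg det h2
    rw [det_mul, h0, zero_mul, det_one] at this
    exact zero_ne_one this
  have h4 := congrArg det h1
  rw [det_mul, det_mul, det_submatrix_equiv_self, det_fromBlocks_zero₁₂] at h4
  have h5 := h4 ▸ mul_ne_zero ha h3
  exact ⟨fun h0 => h5 (by rw [h0]; ring), fun h0 => h5 (by rw [h0]; ring)⟩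

/-- The hypotheses give `a⁻¹ q₂ = v₂ a'⁻¹` and `b w = a u + q₂ b'`; substituting these cancels `a`
and leaves the reduced realization. -/
theorem transfer_mul_eq {F : Type} [Field F] {a : Matrix δ δ F} {b : Matrix δ ν F}
    {c : Matrix μ δ F} {d : Matrix μ ν F} {q₂ v₂ : Matrix δ σ F} {u : Matrix δ ν F}
    {w : Matrix ν ν F} {a' : Matrix σ σ F} {b' : Matrix σ ν F} {c' : Matrix μ σ F}
    {d' : Matrix μ ν F} (ha : a.det ≠ 0) (ha' : a'.det ≠ 0) (h₁ : a * v₂ = q₂ * a')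
    (h₂ : a * u - b * w = -(q₂ * b')) (h₃ : c * v₂ = c') (h₄ : c * u + d * w = d') :
    (c * a⁻¹ * b + d) * w = c' * a'⁻¹ * b' + d' := by
  have e1 : a⁻¹ * a = 1 := nonsing_inv_mul _ (isUnit_iff_ne_zero.2 ha)
  have e2 : a' * a'⁻¹ = 1 := mul_nonsing_inv _ (isUnit_iff_ne_zero.2 ha')
  have e3 : a⁻¹ * q₂ = v₂ * a'⁻¹ := by
    calc a⁻¹ * q₂ = a⁻¹ * (q₂ * a') * a'⁻¹ := by
          rw [Matrix.mul_assoc, Matrix.mul_assoc q₂, e2, Matrix.mul_one]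
      _ = v₂ * a'⁻¹ := by rw [← h₁, ← Matrix.mul_assoc, e1, Matrix.one_mul]
  have e4 : b * w = a * u + q₂ * b' := by
    rw [sub_eq_iff_eq_add] at h₂
    rw [h₂]
    abel
  calc (c * a⁻¹ * b + d) * w = c * (a⁻¹ * (b * w)) + d * w := by
        simp only [Matrix.add_mul, Matrix.mul_assoc]
    _ = c * (a⁻¹ * a * u + a⁻¹ * q₂ * b') + d * w := by
        rw [e4, Matrix.mul_add, Matrix.mul_assoc, Matrix.mul_assoc]
    _ = c' * a'⁻¹ * b' + d' := by
        rw [e1, e3, Matrix.one_mul, Matrix.mul_add, ← h₄, ← h₃]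
        simp only [Matrix.mul_assoc]
        abel

end MatrixIdentities

section MinorIdealInvariance

variable {m n p q : Type} [Fintype m] [DecidableEq m] [Fintype n] [DecidableEq n] [Fintype p]
  [Fintype q]

theorem minorIdeal_mul_mul_of_inv (M : Matrix m n ℂ[X]) {U : Matrix p m ℂ[X]}
    {U' : Matrix m p ℂ[X]} {V : Matrix n q ℂ[X]} {V' : Matrix q n ℂ[X]} (hU : U' * U = 1)
    (hV : V * V' = 1) (k : ℕ) : minorIdeal (U * M * V) k = minorIdeal M k := by
  apply le_antisymm
  · exact (minorIdeal_mul_le_left _ _ k).trans (minorIdeal_mul_le_right _ _ k)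
  · have h : M = U' * (U * M * V) * V' := by
      rw [Matrix.mul_assoc U, ← Matrix.mul_assoc U', hU, Matrix.one_mul, Matrix.mul_assoc, hV,
        Matrix.mul_one]
    calc minorIdeal M k = minorIdeal (U' * (U * M * V) * V') k := by rw [← h]
      _ ≤ _ := (minorIdeal_mul_le_left _ _ k).trans (minorIdeal_mul_le_right _ _ k)

end MinorIdealInvariance

/-! ### The homogeneous form, treating the polynomial, reversed, evaluated and rational versions of
a pencil together. -/

namespace Pencil

open Matrix

variable {m n p q n₁ n₂ m₁ m₂ : Type}

/-- The homogeneous form `α * lead - β * const` of a pencil, over any algebra. -/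
def hom {R : Type} [CommRing R] [Algebra ℂ R] (P : Pencil m n) (α β : R) : Matrix m n R :=
  α • P.lead.map (algebraMap ℂ R) - β • P.const.map (algebraMap ℂ R)

theorem poly_eq_hom (P : Pencil m n) : P.poly = P.hom (X : ℂ[X]) 1 := by
  simp [poly, hom]

theorem rev_eq_hom (P : Pencil m n) : P.rev = P.hom 1 (X : ℂ[X]) := by
  simp [rev, hom]

theorem hom_map {R T : Type} [CommRing R] [Algebra ℂ R] [CommRing T] [Algebra ℂ T] (f : R →ₐ[ℂ] T)
    (P : Pencil m n) (α β : R) : (P.hom α β).map f = P.hom (f α) (f β) := by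
  ext i j
  simp [hom]

theorem ratFunc_eq_hom (P : Pencil m n) :
    P.ratFunc = P.hom (algebraMap ℂ[X] (RatFunc ℂ) X) 1 := by
  rw [ratFunc, poly_eq_hom]
  have := hom_map (IsScalarTower.toAlgHom ℂ ℂ[X] (RatFunc ℂ)) P X 1
  rw [map_one] at this
  exact this

theorem hom_fromCols {R : Type} [CommRing R] [Algebra ℂ R] (P : Pencil m n₁) (Q : Pencil m n₂)
    (α β : R) : (P.fromCols Q).hom α β = Matrix.fromCols (P.hom α β) (Q.hom α β) := by
  ext i (j | j) <;> simp [hom, fromCols]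

theorem hom_fromRows {R : Type} [CommRing R] [Algebra ℂ R] (P : Pencil m₁ n) (Q : Pencil m₂ n)
    (α β : R) : (P.fromRows Q).hom α β = Matrix.fromRows (P.hom α β) (Q.hom α β) := by
  ext (i | i) j <;> simp [hom, fromRows]

theorem neg_lead (P : Pencil m n) : (-P).lead = -P.lead := rfl

theorem neg_const (P : Pencil m n) : (-P).const = -P.const := rfl

theorem hom_neg {R : Type} [CommRing R] [Algebra ℂ R] (P : Pencil m n) (α β : R) :
    (-P).hom α β = -P.hom α β := by
  ext i j
  simp [hom, neg_lead, neg_const]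
  ring

/-- The pencil `U P V` for constant matrices `U` and `V`. -/
def conj [Fintype m] [Fintype n] (U : Matrix p m ℂ) (P : Pencil m n) (V : Matrix n q ℂ) :
    Pencil p q :=
  ⟨U * P.lead * V, U * P.const * V⟩

theorem hom_conj [Fintype m] [Fintype n] {R : Type} [CommRing R] [Algebra ℂ R]
    (U : Matrix p m ℂ) (P : Pencil m n) (V : Matrix n q ℂ) (α β : R) :
    (conj U P V).hom α β =
      U.map (algebraMap ℂ R) * P.hom α β * V.map (algebraMap ℂ R) := by
  simp only [conj, hom, Matrix.map_mul, Matrix.mul_sub, Matrix.sub_mul, Matrix.mul_smul,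
    Matrix.smul_mul]

theorem IsRegular.det_hom_one_X_ne_zero [Fintype n] [DecidableEq n] {P : Pencil n n} (h : P.IsRegular) :
    (P.hom 1 (X : ℂ[X])).det ≠ 0 := by
  rw [← rev_eq_hom]
  exact h.det_rev_ne_zero

/-- Full row rank of `s` at every point makes its maximal minors generate the unit ideal, so `s` is
right invertible over the polynomial ring. -/
theorem minorIdeal_eq_of_staircase {δ ρ σ ε γ : Type} [Fintype δ] [DecidableEq δ] [Fintype ρ]
    [DecidableEq ρ] [Fintype σ] [DecidableEq σ] [Fintype ε] [DecidableEq ε] [Fintype γ]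
    {M : Matrix δ ε ℂ[X]} {U : Matrix (ρ ⊕ σ) δ ℂ[X]} {U' : Matrix δ (ρ ⊕ σ) ℂ[X]}
    {V : Matrix ε (ρ ⊕ γ) ℂ[X]} {V' : Matrix (ρ ⊕ γ) ε ℂ[X]} (hU : U' * U = 1) (hV : V * V' = 1)
    {x : Matrix ρ ρ ℂ[X]} {y : Matrix σ ρ ℂ[X]} {s : Matrix σ γ ℂ[X]}
    (h : U * M * V = fromBlocks x 0 y s)
    (hs : ∀ a v, v ᵥ* s.map (eval a) = 0 → v = 0) (k : ℕ) :
    minorIdeal M (k + Fintype.card σ) = minorIdeal x k := by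
  obtain ⟨T, hT⟩ := exists_mul_eq_one_of_minorIdeal_eq_top s (minorIdeal_card_eq_top s hs)
  rw [← minorIdeal_mul_mul_of_inv M hU hV, h]
  exact minorIdeal_fromBlocks_of_mul_eq_one x y s T hT k

theorem elementaryExponents_eq_of_minorIdeal_eq_add_card {δ ε ρ : Type} [Fintype ρ] [DecidableEq ρ]
    {M : Matrix δ ε ℂ[X]} {x : Matrix ρ ρ ℂ[X]} {s : ℕ} (hx : x.det ≠ 0)
    (h : ∀ k, minorIdeal M (k + s) = minorIdeal x k) (a : ℂ) :
    elementaryExponents M a = elementaryExponents x a := by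
  refine elementaryExponents_eq_of_minorIdeal_add M x s (Fintype.card ρ) h (fun k => ?_) a
  have hb : minorIdeal x (Fintype.card ρ) ≠ ⊥ := by
    rw [minorIdeal_card]
    simpa using hx
  refine ⟨fun hk => ?_, fun hk h0 => hb (eq_bot_iff.2 (h0 ▸ minorIdeal_antitone x hk))⟩
  by_contra hlt
  exact hk (minorIdeal_eq_bot_of_card_lt x (not_le.1 hlt))

theorem poly_map_eval_eq_hom (P : Pencil m n) (a : ℂ) : P.poly.map (eval a) = P.hom a 1 := by
  rw [poly_map_eval]
  ext i j
  simp [hom]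

theorem rev_map_eval_eq_hom (P : Pencil m n) (a : ℂ) : P.rev.map (eval a) = P.hom 1 a := by
  rw [rev_map_eval]
  ext i j
  simp [hom]

/-- A pencil whose homogeneous form is injective at all points has no eigenvalues. -/
theorem forall_not_isEigenvalue_of_injective [Fintype m] [Fintype n] (P : Pencil m n)
    (h : ∀ α β : ℂ, (α ≠ 0 ∨ β ≠ 0) → ∀ v, P.hom α β *ᵥ v = 0 → v = 0) (z : OnePoint ℂ) :
    ¬ P.IsEigenvalue z := by
  rw [IsEigenvalue, not_not]
  induction z using OnePoint.rec with
  | infty =>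
    refine elementaryExponents_eq_zero_of_mulVec _ _ fun v hv => h 1 0 (Or.inl one_ne_zero) v ?_
    rwa [rev_map_eval_eq_hom] at hv
  | coe a =>
    refine elementaryExponents_eq_zero_of_mulVec _ _ fun v hv => h a 1 (Or.inr one_ne_zero) v ?_
    rwa [poly_map_eval_eq_hom] at hv

/-- A pencil whose homogeneous form is surjective at all points has no eigenvalues. -/
theorem forall_not_isEigenvalue_of_surjective [Fintype m] [Fintype n] (P : Pencil m n)
    (h : ∀ α β : ℂ, (α ≠ 0 ∨ β ≠ 0) → ∀ v, v ᵥ* P.hom α β = 0 → v = 0) (z : OnePoint ℂ) :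
    ¬ P.IsEigenvalue z := by
  rw [IsEigenvalue, not_not]
  induction z using OnePoint.rec with
  | infty =>
    refine elementaryExponents_eq_zero_of_vecMul _ _ fun v hv => h 1 0 (Or.inl one_ne_zero) v ?_
    rwa [rev_map_eval_eq_hom] at hv
  | coe a =>
    refine elementaryExponents_eq_zero_of_vecMul _ _ fun v hv => h a 1 (Or.inr one_ne_zero) v ?_
    rwa [poly_map_eval_eq_hom] at hv

/-- A pencil of full column normal rank without eigenvalues is injective at all points. -/
theorem injective_of_forall_not_isEigenvalue [Fintype n] (P : Pencil m n)
    (h : ∀ z, ¬ P.IsEigenvalue z) (hp : minorIdeal P.poly (Fintype.card n) ≠ ⊥)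
    (hr : minorIdeal P.rev (Fintype.card n) ≠ ⊥) (α β : ℂ) (hαβ : α ≠ 0 ∨ β ≠ 0) (v : n → ℂ)
    (hv : P.hom α β *ᵥ v = 0) : v = 0 := by
  by_cases hβ : β = 0
  · have hα : α ≠ 0 := hαβ.resolve_right (not_not.2 hβ)
    refine eq_zero_of_mulVec_of_elementaryExponents P.rev 0 hr (not_not.1 (h OnePoint.infty)) v ?_
    have h1 : P.hom α β = α • P.rev.map (eval 0) := by
      rw [rev_map_eval_eq_hom]
      ext i j
      simp [hom, hβ]
    rw [h1, smul_mulVec] at hv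
    exact (smul_eq_zero.1 hv).resolve_left hα
  · refine eq_zero_of_mulVec_of_elementaryExponents P.poly (α / β) hp
      (not_not.1 (h ((α / β : ℂ) : OnePoint ℂ))) v ?_
    have h1 : P.hom α β = β • P.poly.map (eval (α / β)) := by
      rw [poly_map_eval_eq_hom]
      ext i j
      simp [hom]
      field_simp
    rw [h1, smul_mulVec] at hv
    exact (smul_eq_zero.1 hv).resolve_left hβ

end Pencil

/-! ### Consequences of the staircase form for the system matrix. -/

section StaircaseConsequences

open Matrix

variable {δ ρ σ ν μ : Type} [Fintype δ] [DecidableEq δ] [Fintype ρ] [DecidableEq ρ] [Fintype σ]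
  [DecidableEq σ] [Fintype ν] [DecidableEq ν] [Fintype μ] [DecidableEq μ]

theorem map_fromCols {α β : Type} {m n p : Type} (f : α → β) (M : Matrix m n α)
    (N : Matrix m p α) : (Matrix.fromCols M N).map f = Matrix.fromCols (M.map f) (N.map f) := by
  ext i (j | j) <;> rfl

theorem map_fromRows {α β : Type} {m n p : Type} (f : α → β) (M : Matrix m n α)
    (N : Matrix p n α) : (Matrix.fromRows M N).map f = Matrix.fromRows (M.map f) (N.map f) := by
  ext (i | i) j <;> rfl

theorem Pencil.hom_mul_eq {m n p q R : Type} [Fintype n] [Fintype p] [CommRing R] [Algebra ℂ R]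
    {P : Pencil m n} {P' : Pencil p q} {V : Matrix n q ℂ} {U : Matrix m p ℂ}
    (h₁ : P.lead * V = U * P'.lead) (h₀ : P.const * V = U * P'.const) (α β : R) :
    P.hom α β * V.map (algebraMap ℂ R) = U.map (algebraMap ℂ R) * P'.hom α β := by
  simp only [Pencil.hom, Matrix.mul_sub, Matrix.sub_mul, Matrix.mul_smul, Matrix.smul_mul,
    ← Matrix.map_mul, h₁, h₀]

theorem Pencil.hom_fromBlocks {m n p q R : Type} [CommRing R] [Algebra ℂ R] (P : Pencil m n)
    (P₁ : Pencil m q) (P₂ : Pencil p n) (P₃ : Pencil p q) (α β : R) :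
    (⟨fromBlocks P.lead P₁.lead P₂.lead P₃.lead,
      fromBlocks P.const P₁.const P₂.const P₃.const⟩ : Pencil (m ⊕ p) (n ⊕ q)).hom α β =
      fromBlocks (P.hom α β) (P₁.hom α β) (P₂.hom α β) (P₃.hom α β) := by
  ext (i | i) (j | j) <;> simp [Pencil.hom]

theorem Pencil.hom_zero {m n R : Type} [CommRing R] [Algebra ℂ R] (α β : R) :
    (⟨0, 0⟩ : Pencil m n).hom α β = 0 := by
  ext
  simp [Pencil.hom]

theorem fromBlocks_mul_blockW (V₁ : Matrix δ ρ ℂ) (V₂ : Matrix δ σ ℂ) (W₁₁ : Matrix ρ ρ ℂ)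
    (W₁₃ : Matrix ρ ν ℂ) (W₃₁ : Matrix ν ρ ℂ) (W₃₃ : Matrix ν ν ℂ) :
    fromBlocks (fromCols V₁ V₂) 0 0 (1 : Matrix ν ν ℂ) *
        (blockW W₁₁ W₁₃ W₃₁ W₃₃ : Matrix ((ρ ⊕ σ) ⊕ ν) ((ρ ⊕ σ) ⊕ ν) ℂ) =
      fromCols (fromCols (fromRows (V₁ * W₁₁) W₃₁) (fromRows V₂ 0))
        (fromRows (V₁ * W₁₃) W₃₃) := by
  rw [blockW, fromBlocks_multiply]
  simp only [fromCols_mul_fromBlocks, fromCols_mul_fromRows, Matrix.zero_mul, Matrix.one_mul,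
    Matrix.mul_zero, Matrix.mul_one, add_zero, zero_add]
  ext (i | i) ((j | j) | j) <;> simp

theorem eq_mul_of_mul_eq_zero {γ : Type} {Q₁ : Matrix δ ρ ℂ} {Q₂ : Matrix δ σ ℂ}
    (hQ : fromCols Q₁ Q₂ * (fromCols Q₁ Q₂)ᴴ = 1) {M : Matrix δ γ ℂ} (h : Q₁ᴴ * M = 0) :
    M = Q₂ * (Q₂ᴴ * M) := by
  rw [conjTranspose_fromCols_eq_fromRows_conjTranspose, fromCols_mul_fromRows] at hQ
  calc M = (Q₁ * Q₁ᴴ + Q₂ * Q₂ᴴ) * M := by rw [hQ, Matrix.one_mul]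
    _ = Q₂ * (Q₂ᴴ * M) := by
      rw [Matrix.add_mul, Matrix.mul_assoc, Matrix.mul_assoc, h, Matrix.mul_zero, zero_add]

/-- If `W₃₃ x = 0`, orthogonality of the two block columns gives `W₁₁ᴴ W₁₃ x = 0`, hence `W₁₃ x =
0`; the second block column then kills `x`, although its columns are orthonormal. -/
theorem isUnit_det_of_unitary_blocks {W₁₁ : Matrix ρ ρ ℂ} {W₁₃ : Matrix ρ ν ℂ}
    {W₃₁ : Matrix ν ρ ℂ} {W₃₃ : Matrix ν ν ℂ}
    (h : (fromBlocks W₁₁ W₁₃ W₃₁ W₃₃)ᴴ * fromBlocks W₁₁ W₁₃ W₃₁ W₃₃ = 1)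
    (h₁₁ : (W₁₁ᴴ).det ≠ 0) : IsUnit W₃₃.det := by
  rw [fromBlocks_conjTranspose, fromBlocks_multiply, ← fromBlocks_one, fromBlocks_inj] at h
  obtain ⟨-, h12, -, h22⟩ := h
  rw [isUnit_iff_ne_zero]
  intro h0
  obtain ⟨x, hx, hWx⟩ := exists_mulVec_eq_zero_iff.2 h0
  have h1 : W₁₃ *ᵥ x = 0 := by
    by_contra hne
    apply h₁₁
    refine exists_mulVec_eq_zero_iff.1 ⟨_, hne, ?_⟩
    have := congrArg (· *ᵥ x) h12
    simpa [add_mulVec, ← mulVec_mulVec, hWx] using this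
  apply hx
  have := congrArg (· *ᵥ x) h22
  simpa [add_mulVec, ← mulVec_mulVec, hWx, h1] using this.symm

/-- Unitarity of `W` expresses `[V₁; 0]` as `[V₁ W₁₁; W₃₁] W₁₁ᴴ + [V₁ W₁₃; W₃₃] W₁₃ᴴ`, and `Q₁ᴴ M`
annihilates the second term. For `M = [A -B]` the left side is `A V`, so this brings `A` alone to
block triangular form. -/
theorem mul_fromBlocks_of_staircase {Q₁ V₁ : Matrix δ ρ ℂ} {Q₂ V₂ : Matrix δ σ ℂ}
    {W₁₁ : Matrix ρ ρ ℂ} {W₁₃ : Matrix ρ ν ℂ} {W₃₁ : Matrix ν ρ ℂ} {W₃₃ : Matrix ν ν ℂ}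
    (hQ : fromCols Q₁ Q₂ * (fromCols Q₁ Q₂)ᴴ = 1)
    (hW : fromBlocks W₁₁ W₁₃ W₃₁ W₃₃ * (fromBlocks W₁₁ W₁₃ W₃₁ W₃₃)ᴴ = 1)
    {M : Matrix δ (δ ⊕ ν) ℂ} (h₂ : Q₁ᴴ * M * fromRows V₂ (0 : Matrix ν σ ℂ) = 0)
    (h₃ : Q₁ᴴ * M * fromRows (V₁ * W₁₃) W₃₃ = 0) :
    M * fromRows (fromCols V₁ V₂) (0 : Matrix ν (ρ ⊕ σ) ℂ) = fromCols Q₁ Q₂ *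
      fromBlocks (Q₁ᴴ * M * fromRows (V₁ * W₁₁) W₃₁ * W₁₁ᴴ) (0 : Matrix ρ σ ℂ)
        (Q₂ᴴ * M * fromRows V₁ (0 : Matrix ν ρ ℂ)) (Q₂ᴴ * M * fromRows V₂ (0 : Matrix ν σ ℂ)) := by
  rw [fromBlocks_conjTranspose, fromBlocks_multiply, ← fromBlocks_one, fromBlocks_inj] at hW
  obtain ⟨hW1, -, hW2, -⟩ := hW
  have h1 : fromRows (fromCols V₁ V₂) (0 : Matrix ν (ρ ⊕ σ) ℂ) =
      fromCols (fromRows V₁ 0) (fromRows V₂ 0) := by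
    ext (i | i) (j | j) <;> rfl
  have h2 : fromRows V₁ (0 : Matrix ν ρ ℂ) =
      fromRows (V₁ * W₁₁) W₃₁ * W₁₁ᴴ + fromRows (V₁ * W₁₃) W₃₃ * W₁₃ᴴ := by
    have h3 : V₁ = V₁ * W₁₁ * W₁₁ᴴ + V₁ * W₁₃ * W₁₃ᴴ := by
      rw [Matrix.mul_assoc, Matrix.mul_assoc, ← Matrix.mul_add, hW1, Matrix.mul_one]
    rw [fromRows_mul, fromRows_mul]
    ext (i | i) j
    · exact congrFun (congrFun h3 i) j
    · exact congrFun (congrFun hW2.symm i) j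
  have h4 : Q₁ᴴ * M * fromRows V₁ (0 : Matrix ν ρ ℂ) =
      Q₁ᴴ * M * fromRows (V₁ * W₁₁) W₃₁ * W₁₁ᴴ := by
    rw [h2, Matrix.mul_add, ← Matrix.mul_assoc, ← Matrix.mul_assoc _ _ W₁₃ᴴ, h₃, Matrix.zero_mul,
      add_zero]
  rw [← Matrix.one_mul (M * fromRows (fromCols V₁ V₂) (0 : Matrix ν (ρ ⊕ σ) ℂ)), ← hQ,
    Matrix.mul_assoc, conjTranspose_fromCols_eq_fromRows_conjTranspose, h1, mul_fromCols,
    fromRows_mul_fromCols, ← h4, ← h₂]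
  simp only [Matrix.mul_assoc]

/-- The block triangular decomposition of a system matrix whose top rows are in staircase form. -/
theorem exists_blockTriangular (e : δ ≃ ρ ⊕ σ) (A : Pencil δ δ) (B : Pencil δ ν) (C : Pencil μ δ)
    (D : Pencil μ ν) (hA : A.IsRegular) {Q₁ V₁ : Matrix δ ρ ℂ} {Q₂ V₂ : Matrix δ σ ℂ}
    {W₁₁ : Matrix ρ ρ ℂ} {W₁₃ : Matrix ρ ν ℂ} {W₃₁ : Matrix ν ρ ℂ} {W₃₃ : Matrix ν ν ℂ}
    (hQ' : fromCols Q₁ Q₂ * (fromCols Q₁ Q₂)ᴴ = 1)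
    (hV : (fromCols V₁ V₂)ᴴ * fromCols V₁ V₂ = 1)
    (hV' : fromCols V₁ V₂ * (fromCols V₁ V₂)ᴴ = 1)
    (hW : fromBlocks W₁₁ W₁₃ W₃₁ W₃₃ ∈ unitaryGroup (ρ ⊕ ν) ℂ)
    (h₁ : Q₁ᴴ * (A.fromCols (-B)).lead * fromBlocks V₂ (V₁ * W₁₃) 0 W₃₃ = 0)
    (h₀ : Q₁ᴴ * (A.fromCols (-B)).const * fromBlocks V₂ (V₁ * W₁₃) 0 W₃₃ = 0)
    (hrow : ∀ α β : ℂ, (α ≠ 0 ∨ β ≠ 0) → ∀ v : σ → ℂ,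
      v ᵥ* (Q₂ᴴ * (α • (A.fromCols (-B)).lead - β • (A.fromCols (-B)).const) *
        fromBlocks V₂ (V₁ * W₁₃) 0 W₃₃) = 0 → v = 0) :
    ∃ (Xc : Pencil ρ ρ) (Yc : Pencil σ ρ) (Zc : Pencil μ ρ) (Ac : Pencil σ σ) (Bc : Pencil σ ν)
      (Cc : Pencil μ σ) (Dc : Pencil μ ν),
      (fromBlocks (fromCols Q₁ Q₂)ᴴ 0 0 (1 : Matrix μ μ ℂ)).map Polynomial.C *
          systemMatrix A B C D *
          (fromBlocks (fromCols V₁ V₂) 0 0 (1 : Matrix ν ν ℂ)).map Polynomial.C *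
          (blockW W₁₁ W₁₃ W₃₁ W₃₃ : Matrix ((ρ ⊕ σ) ⊕ ν) ((ρ ⊕ σ) ⊕ ν) ℂ).map Polynomial.C =
        blockTriangular Xc Yc Zc Ac Bc Cc Dc ∧
      Xc.IsRegular ∧
      (∀ z : OnePoint ℂ, (A.fromCols (-B)).blockSizes z = Xc.blockSizes z) ∧
      (∀ z : OnePoint ℂ, ¬ (Ac.fromCols (-Bc)).IsEigenvalue z) ∧
      Realizes Ac Bc Cc Dc (transferFunction A B C D * W₃₃.map (RatFunc.C)) ∧
      IsUnit W₃₃.det ∧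
      ((∀ z : OnePoint ℂ, ¬ (A.fromRows C).IsEigenvalue z) →
        ∀ z : OnePoint ℂ, ¬ (Ac.fromRows Cc).IsEigenvalue z) := by
  set S := A.fromCols (-B) with hS
  set T := C.fromCols D with hT
  set Z₁ := fromRows (V₁ * W₁₁) W₃₁ with hZ₁
  set Z₂ : Matrix (δ ⊕ ν) σ ℂ := fromRows V₂ 0 with hZ₂
  set Z₃ := fromRows (V₁ * W₁₃) W₃₃ with hZ₃
  have hZr : fromBlocks V₂ (V₁ * W₁₃) 0 W₃₃ = fromCols Z₂ Z₃ := by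
    ext (i | i) (j | j) <;> rfl
  rw [hZr] at h₁ h₀ hrow
  have hW' := mem_unitaryGroup_iff'.1 hW
  have hWW := mem_unitaryGroup_iff.1 hW
  rw [star_eq_conjTranspose] at hW' hWW
  have split : ∀ {M : Matrix δ (δ ⊕ ν) ℂ}, Q₁ᴴ * M * fromCols Z₂ Z₃ = 0 →
      Q₁ᴴ * M * Z₂ = 0 ∧ Q₁ᴴ * M * Z₃ = 0 := fun {M} h => by
    rw [mul_fromCols, ← fromCols_zero] at h
    exact fromCols_inj h
  obtain ⟨h₁₂, h₁₃⟩ := split h₁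
  obtain ⟨h₀₂, h₀₃⟩ := split h₀
  let Xc := Pencil.conj Q₁ᴴ S Z₁
  let Yc := Pencil.conj Q₂ᴴ S Z₁
  let Ac := Pencil.conj Q₂ᴴ S Z₂
  let Bc := -Pencil.conj Q₂ᴴ S Z₃
  let Zc := Pencil.conj (1 : Matrix μ μ ℂ) T Z₁
  let Cc := Pencil.conj (1 : Matrix μ μ ℂ) T Z₂
  let Dc := Pencil.conj (1 : Matrix μ μ ℂ) T Z₃
  have hconj1 : ∀ {n : Type} (P : Pencil μ (δ ⊕ ν)) (Z : Matrix (δ ⊕ ν) n ℂ) {R : Type} [CommRing R]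
      [Algebra ℂ R] (α β : R), (Pencil.conj (1 : Matrix μ μ ℂ) P Z).hom α β =
        P.hom α β * Z.map (algebraMap ℂ R) := fun P Z R _ _ α β => by
    rw [Pencil.hom_conj, Matrix.map_one _ (map_zero _) (map_one _), Matrix.one_mul]
  have hSZ₂ : ∀ {R : Type} [CommRing R] [Algebra ℂ R] (α β : R),
      A.hom α β * V₂.map (algebraMap ℂ R) = Q₂.map (algebraMap ℂ R) * Ac.hom α β := by
    intro R _ _ α β
    refine Pencil.hom_mul_eq ?_ ?_ α β
    · have := eq_mul_of_mul_eq_zero hQ' (M := S.lead * Z₂) (by rw [← Matrix.mul_assoc, h₁₂])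
      rw [← Matrix.mul_assoc Q₂ᴴ] at this
      refine Eq.trans ?_ this
      simp [hS, hZ₂, Pencil.fromCols, fromCols_mul_fromRows]
    · have := eq_mul_of_mul_eq_zero hQ' (M := S.const * Z₂) (by rw [← Matrix.mul_assoc, h₀₂])
      rw [← Matrix.mul_assoc Q₂ᴴ] at this
      refine Eq.trans ?_ this
      simp [hS, hZ₂, Pencil.fromCols, fromCols_mul_fromRows]
  have hSZ₃ : ∀ {R : Type} [CommRing R] [Algebra ℂ R] (α β : R),
      A.hom α β * (V₁ * W₁₃).map (algebraMap ℂ R) - B.hom α β * W₃₃.map (algebraMap ℂ R) =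
        -(Q₂.map (algebraMap ℂ R) * Bc.hom α β) := by
    intro R _ _ α β
    have h : S.hom α β * Z₃.map (algebraMap ℂ R) = Q₂.map (algebraMap ℂ R) *
        (Pencil.conj Q₂ᴴ S Z₃).hom α β := by
      refine Pencil.hom_mul_eq ?_ ?_ α β
      · have := eq_mul_of_mul_eq_zero hQ' (M := S.lead * Z₃) (by rw [← Matrix.mul_assoc, h₁₃])
        rwa [← Matrix.mul_assoc Q₂ᴴ] at this
      · have := eq_mul_of_mul_eq_zero hQ' (M := S.const * Z₃) (by rw [← Matrix.mul_assoc, h₀₃])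
        rwa [← Matrix.mul_assoc Q₂ᴴ] at this
    rw [Pencil.hom_neg, Matrix.mul_neg, neg_neg, ← h, hS, hZ₃, Pencil.hom_fromCols, map_fromRows,
      fromCols_mul_fromRows, Pencil.hom_neg, Matrix.neg_mul, sub_eq_add_neg]
  have hTZ₂ : ∀ {R : Type} [CommRing R] [Algebra ℂ R] (α β : R),
      C.hom α β * V₂.map (algebraMap ℂ R) = Cc.hom α β := by
    intro R _ _ α β
    rw [hconj1, hT, hZ₂, Pencil.hom_fromCols, map_fromRows, fromCols_mul_fromRows,
      Matrix.map_zero _ (map_zero _), Matrix.mul_zero, add_zero]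
  have hTZ₃ : ∀ {R : Type} [CommRing R] [Algebra ℂ R] (α β : R),
      C.hom α β * (V₁ * W₁₃).map (algebraMap ℂ R) + D.hom α β * W₃₃.map (algebraMap ℂ R) =
        Dc.hom α β := by
    intro R _ _ α β
    rw [hconj1, hT, hZ₃, Pencil.hom_fromCols, map_fromRows, fromCols_mul_fromRows]
  have hSr : Ac.fromCols (-Bc) = Pencil.conj Q₂ᴴ S (fromCols Z₂ Z₃) := by
    ext1
    · simp [Ac, Bc, Pencil.fromCols, Pencil.conj, Pencil.neg_lead, mul_fromCols]
    · simp [Ac, Bc, Pencil.fromCols, Pencil.conj, Pencil.neg_const, mul_fromCols]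
  have hSrow : ∀ α β : ℂ, (α ≠ 0 ∨ β ≠ 0) → ∀ v : σ → ℂ,
      v ᵥ* (Ac.fromCols (-Bc)).hom α β = 0 → v = 0 := by
    intro α β hαβ v hv
    apply hrow α β hαβ v
    rw [hSr, Pencil.hom_conj] at hv
    simpa [Pencil.hom] using hv
  have hAV : ∀ {R : Type} [CommRing R] [Algebra ℂ R] (α β : R),
      ∃ y, A.hom α β * (fromCols V₁ V₂).map (algebraMap ℂ R) =
        (fromCols Q₁ Q₂).map (algebraMap ℂ R) *
          fromBlocks (Xc.hom α β * W₁₁ᴴ.map (algebraMap ℂ R)) 0 y (Ac.hom α β) := by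
    intro R _ _ α β
    let X' : Pencil ρ ρ := ⟨Xc.lead * W₁₁ᴴ, Xc.const * W₁₁ᴴ⟩
    let Y' : Pencil σ ρ := Pencil.conj Q₂ᴴ S (fromRows V₁ 0)
    have hX' : X'.hom α β = Xc.hom α β * W₁₁ᴴ.map (algebraMap ℂ R) := by
      simp only [X', Pencil.hom, Matrix.map_mul, Matrix.sub_mul, Matrix.smul_mul]
    refine ⟨Y'.hom α β, ?_⟩
    rw [← hX', ← Pencil.hom_zero (m := ρ) (n := σ) α β, ← Pencil.hom_fromBlocks]
    refine Pencil.hom_mul_eq ?_ ?_ α β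
    · refine Eq.trans ?_ (mul_fromBlocks_of_staircase hQ' hWW h₁₂ h₁₃)
      simp [hS, Pencil.fromCols, fromCols_mul_fromRows]
    · refine Eq.trans ?_ (mul_fromBlocks_of_staircase hQ' hWW h₀₂ h₀₃)
      simp [hS, Pencil.fromCols, fromCols_mul_fromRows]
  -- A single determinant identity yields regularity of `Xc` and `Ac` and invertibility of `W₁₁`. It
  -- is applied at `(X, 1)` and `(1, X)`, covering the pencil and its reversal.
  have hdet : ∀ α β : ℂ[X], (A.hom α β).det ≠ 0 → (Xc.hom α β).det ≠ 0 ∧ (Ac.hom α β).det ≠ 0 ∧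
      (W₁₁ᴴ).det ≠ 0 := by
    intro α β h
    obtain ⟨y, hy⟩ := hAV α β
    have hV2 : (fromCols V₁ V₂).map (algebraMap ℂ ℂ[X]) *
        ((fromCols V₁ V₂)ᴴ).map (algebraMap ℂ ℂ[X]) = 1 := by
      rw [← Matrix.map_mul, hV', Matrix.map_one _ (map_zero _) (map_one _)]
    obtain ⟨hx, hs⟩ := det_ne_zero_of_mul_eq_mul_fromBlocks e hV2 hy h
    rw [det_mul] at hx
    refine ⟨left_ne_zero_of_mul hx, hs, fun h0 => right_ne_zero_of_mul hx ?_⟩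
    have := RingHom.map_det (algebraMap ℂ ℂ[X]) W₁₁ᴴ
    rw [h0, map_zero] at this
    exact this.symm
  obtain ⟨hXp, hAcp, hW11⟩ := hdet X 1 (by rw [← Pencil.poly_eq_hom]; exact hA)
  obtain ⟨hXr, -, -⟩ := hdet 1 X hA.det_hom_one_X_ne_zero
  have hXreg : Xc.IsRegular := by rw [Pencil.IsRegular, Pencil.poly_eq_hom]; exact hXp
  have hAreg : Ac.IsRegular := by rw [Pencil.IsRegular, Pencil.poly_eq_hom]; exact hAcp
  refine ⟨Xc, Yc, Zc, Ac, Bc, Cc, Dc, ?_, hXreg, ?_,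
    Pencil.forall_not_isEigenvalue_of_surjective _ hSrow, ⟨hAreg, ?_⟩,
    isUnit_det_of_unitary_blocks hW' hW11, ?_⟩
  · have hpc : ∀ {p q r t : Type} [Fintype q] [Fintype r] (U : Matrix p q ℂ) (P : Pencil q r)
        (Z : Matrix r t ℂ), (Pencil.conj U P Z).poly =
          U.map Polynomial.C * P.poly * Z.map Polynomial.C := fun U P Z => by
      rw [Pencil.poly_eq_hom, Pencil.hom_conj, Pencil.poly_eq_hom]
      rfl
    have hz : ∀ {t : Type} (Z : Matrix (δ ⊕ ν) t ℂ), Q₁ᴴ * S.lead * Z = 0 → Q₁ᴴ * S.const * Z = 0 →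
        (Pencil.conj Q₁ᴴ S Z).poly = 0 := fun Z hl hc => by
      rw [Pencil.poly_eq_hom, Pencil.conj, hl, hc, Pencil.hom_zero]
    have hsys : systemMatrix A B C D = fromRows S.poly T.poly := by
      simp only [Pencil.poly_eq_hom, hS, hT, Pencil.hom_fromCols, Pencil.hom_neg, systemMatrix]
      ext (i | i) (j | j) <;> rfl
    have hBc : -Bc.poly = (Pencil.conj Q₂ᴴ S Z₃).poly := by
      rw [Pencil.poly_eq_hom, Pencil.poly_eq_hom, Pencil.hom_neg, neg_neg]
    rw [Matrix.mul_assoc, ← Matrix.map_mul, fromBlocks_mul_blockW, hsys,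
      conjTranspose_fromCols_eq_fromRows_conjTranspose, fromBlocks_map, map_fromRows,
      map_fromCols, map_fromCols, Matrix.map_zero _ (map_zero _), Matrix.map_zero _ (map_zero _),
      Matrix.map_one _ (map_zero _) (map_one _), fromBlocks_mul_fromRows, Matrix.zero_mul,
      Matrix.zero_mul, Matrix.one_mul, add_zero, zero_add, fromRows_mul_fromCols, mul_fromCols,
      mul_fromCols, fromRows_mul, fromRows_mul, fromRows_mul, blockTriangular, hBc,
      ← hz Z₂ h₁₂ h₀₂, ← hz Z₃ h₁₃ h₀₃]
    simp only [Xc, Yc, Ac, Zc, Cc, Dc, hpc, Matrix.map_one _ (map_zero _) (map_one _),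
      Matrix.one_mul]
    ext ((i | i) | i) ((j | j) | j) <;> rfl
  -- Finite points and infinity are treated at once; `α` and `β` must have no common zero, so that
  -- the full row rank of `[A_c -B_c]` applies at each evaluation.
  · have key : ∀ α β : ℂ[X], (∀ a, eval a α ≠ 0 ∨ eval a β ≠ 0) → (Xc.hom α β).det ≠ 0 → ∀ a,
        elementaryExponents (S.hom α β) a = elementaryExponents (Xc.hom α β) a := by
      intro α β hαβ hX a
      have hQm : (fromCols Q₁ Q₂).map (algebraMap ℂ ℂ[X]) *
          ((fromCols Q₁ Q₂)ᴴ).map (algebraMap ℂ ℂ[X]) = 1 := by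
        rw [← Matrix.map_mul, hQ', Matrix.map_one _ (map_zero _) (map_one _)]
      have hZm : (fromCols Z₁ (fromCols Z₂ Z₃)).map (algebraMap ℂ ℂ[X]) *
          ((fromCols Z₁ (fromCols Z₂ Z₃))ᴴ).map (algebraMap ℂ ℂ[X]) = 1 := by
        have hZ : fromCols Z₁ (fromCols Z₂ Z₃) = (fromCols (fromCols Z₁ Z₂) Z₃).submatrix id
            (Equiv.sumAssoc ρ σ ν).symm := by
          ext i (j | j | j) <;> rfl
        have hbW : (blockW W₁₁ W₁₃ W₃₁ W₃₃ : Matrix ((ρ ⊕ σ) ⊕ ν) ((ρ ⊕ σ) ⊕ ν) ℂ) *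
            (blockW W₁₁ W₁₃ W₃₁ W₃₃)ᴴ = 1 :=
          mem_unitaryGroup_iff.1 (blockW_mem_unitaryGroup hW)
        rw [← Matrix.map_mul, hZ, conjTranspose_submatrix, submatrix_mul_equiv, submatrix_id_id,
          ← fromBlocks_mul_blockW, conjTranspose_mul, Matrix.mul_assoc,
          ← Matrix.mul_assoc (blockW W₁₁ W₁₃ W₃₁ W₃₃), hbW, Matrix.one_mul,
          fromBlocks_conjTranspose, fromBlocks_multiply, hV']
        simp
      refine Pencil.elementaryExponents_eq_of_minorIdeal_eq_add_card hX
        (Pencil.minorIdeal_eq_of_staircase hQm hZm (y := Yc.hom α β)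
          (s := (Ac.fromCols (-Bc)).hom α β) ?_ ?_) a
      · have hz : (0 : Matrix ρ (σ ⊕ ν) ℂ[X]) = (Pencil.conj Q₁ᴴ S (fromCols Z₂ Z₃)).hom α β := by
          rw [Pencil.conj, h₁, h₀, Pencil.hom_zero]
        rw [hz, hSr, ← Pencil.hom_conj, ← Pencil.hom_fromBlocks]
        congr 1
        simp only [Pencil.conj, conjTranspose_fromCols_eq_fromRows_conjTranspose, fromRows_mul,
          mul_fromCols, Xc, Yc]
        ext (i | i) (j | j) <;> rfl
      · intro a v hv
        refine hSrow _ _ (hαβ a) v ?_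
        rw [← hv]
        congr 1
        exact (Pencil.hom_map (aeval a) (Ac.fromCols (-Bc)) α β).symm
    intro z
    induction z using OnePoint.rec with
    | infty =>
      change elementaryExponents S.rev 0 = elementaryExponents Xc.rev 0
      rw [Pencil.rev_eq_hom, Pencil.rev_eq_hom]
      exact key 1 X (fun a => Or.inl (by simp)) hXr 0
    | coe a =>
      change elementaryExponents S.poly a = elementaryExponents Xc.poly a
      rw [Pencil.poly_eq_hom, Pencil.poly_eq_hom]
      exact key X 1 (fun a => Or.inr (by simp)) hXp a
  · have hreg : ∀ {τ : Type} [Fintype τ] [DecidableEq τ] {P : Pencil τ τ}, P.IsRegular →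
        P.ratFunc.det ≠ 0 := by
      intro τ _ _ P hP
      have := RingHom.map_det (algebraMap ℂ[X] (RatFunc ℂ)) P.poly
      intro h0
      rw [Pencil.ratFunc] at h0
      rw [RingHom.mapMatrix_apply, h0] at this
      exact hP ((map_eq_zero_iff _ (RatFunc.algebraMap_injective ℂ)).1 this)
    have hW33 : W₃₃.map (RatFunc.C) = W₃₃.map (algebraMap ℂ (RatFunc ℂ)) := by
      rw [RatFunc.algebraMap_eq_C]
    have hAr := hreg hA
    have hAcr := hreg hAreg
    simp only [transferFunction, hW33, Pencil.ratFunc_eq_hom] at hAr hAcr ⊢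
    exact transfer_mul_eq hAr hAcr (hSZ₂ _ _) (hSZ₃ _ _) (hTZ₂ _ _) (hTZ₃ _ _)
  -- A kernel vector `v` of `[A_c; C_c]` gives the kernel vector `V₂ v` of `[A; C]`. Regularity of
  -- `A` supplies the full column normal rank that turns absence of eigenvalues into injectivity.
  · intro h z
    refine Pencil.forall_not_isEigenvalue_of_injective _ (fun α β hαβ v hv => ?_) z
    have hdet : ∀ α β : ℂ[X], (A.hom α β).det ≠ 0 →
        minorIdeal ((A.fromRows C).hom α β) (Fintype.card δ) ≠ ⊥ := by
      intro α β hne h0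
      have hle := minorIdeal_submatrix_le ((A.fromRows C).hom α β) Sum.inl id (Fintype.card δ)
      rw [h0, Pencil.hom_fromRows] at hle
      change minorIdeal (A.hom α β) _ ≤ _ at hle
      rw [minorIdeal_card, le_bot_iff, Ideal.span_singleton_eq_bot] at hle
      exact hne hle
    have hinj := Pencil.injective_of_forall_not_isEigenvalue _ h
      (by rw [Pencil.poly_eq_hom]; exact hdet _ _ (by rw [← Pencil.poly_eq_hom]; exact hA))
      (by rw [Pencil.rev_eq_hom]; exact hdet _ _ hA.det_hom_one_X_ne_zero) α β hαβ (V₂ *ᵥ v) (by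
        have e₁ := hSZ₂ α β
        have e₂ := hTZ₂ α β
        rw [Pencil.hom_fromRows, fromRows_mulVec] at hv ⊢
        have e₃ : Ac.hom α β *ᵥ v = 0 := funext fun i => congrFun hv (Sum.inl i)
        have e₄ : Cc.hom α β *ᵥ v = 0 := funext fun i => congrFun hv (Sum.inr i)
        simp only [Algebra.algebraMap_self, RingHom.coe_id, Matrix.map_id] at e₁ e₂
        rw [mulVec_mulVec, mulVec_mulVec, e₁, e₂, e₄, ← mulVec_mulVec, e₃, mulVec_zero]
        ext (i | i) <;> rfl)
    have hV22 := (toCols_of_conjTranspose_mul hV).2.2.2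
    rw [toCols₂_fromCols] at hV22
    exact mulVec_eq_zero_of_conjTranspose_mul hV22 hinj

end StaircaseConsequences

/-! ### The theorem for indices in `Fin`. -/

theorem Pencil.IsRegular.exists_det_hom_ne_zero {n : Type} [Fintype n] [DecidableEq n]
    {P : Pencil n n} (h : P.IsRegular) : ∃ a : ℂ, (P.hom a 1).det ≠ 0 := by
  by_contra! hall
  refine h (Polynomial.funext fun a => ?_)
  rw [eval_zero, ← hall a, ← poly_map_eval_eq_hom, ← coe_evalRingHom, RingHom.map_det]
  rfl

theorem mulVecLin_smul_sub_smul_apply {m n : Type} [Fintype n] (P Q : Matrix m n ℂ) (α β : ℂ)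
    (x : n → ℂ) : (α • P.mulVecLin - β • Q.mulVecLin) x = (α • P - β • Q).mulVec x := by
  simp [Matrix.sub_mulVec, Matrix.smul_mulVec]

theorem exists_surjective_fromCols {δ ν : Type} [Fintype δ] [DecidableEq δ] [Fintype ν]
    {A : Pencil δ δ} (hA : A.IsRegular) (B : Pencil δ ν) :
    ∃ α β : ℂ, Function.Surjective
      (α • (A.fromCols B).lead.mulVecLin - β • (A.fromCols B).const.mulVecLin) := by
  obtain ⟨a, ha⟩ := hA.exists_det_hom_ne_zero
  refine ⟨a, 1, fun y => ⟨Sum.elim ((A.hom a 1)⁻¹.mulVec y) 0, ?_⟩⟩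
  rw [mulVecLin_smul_sub_smul_apply]
  have h : a • (A.fromCols B).lead - (1 : ℂ) • (A.fromCols B).const = (A.fromCols B).hom a 1 := by
    simp [Pencil.hom]
  rw [h, Pencil.hom_fromCols, Matrix.fromCols_mulVec_sumElim, Matrix.mulVec_zero, add_zero,
    Matrix.mulVec_mulVec, Matrix.mul_nonsing_inv _ (isUnit_iff_ne_zero.2 ha), Matrix.one_mulVec]

/-- The unitary factors are built with one side indexed by a sum; this identifies the square version
required in the theorem with that one. -/
theorem reindex_diagOne_mul {d m n r s : ℕ} (h : r + s = d)
    (U : Matrix (Fin r ⊕ Fin s) (Fin d) ℂ) (V : Matrix (Fin d) (Fin r ⊕ Fin s) ℂ)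
    (M : Matrix (Fin d ⊕ Fin m) (Fin d ⊕ Fin n) ℂ[X]) :
    Matrix.reindex (splitIndex h m) (splitIndex h n)
      (diagOne (Fin m) (U.submatrix (finSumFinEquiv.trans (finCongr h)).symm id) * M *
        diagOne (Fin n) (V.submatrix id (finSumFinEquiv.trans (finCongr h)).symm)) =
      (Matrix.fromBlocks U 0 0 (1 : Matrix (Fin m) (Fin m) ℂ)).map C * M *
        (Matrix.fromBlocks V 0 0 (1 : Matrix (Fin n) (Fin n) ℂ)).map C := by
  have h1 : (Matrix.fromBlocks U 0 0 (1 : Matrix (Fin m) (Fin m) ℂ)).map C =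
      (diagOne (Fin m) (U.submatrix (finSumFinEquiv.trans (finCongr h)).symm id)).submatrix
        (splitIndex h m).symm id := by
    ext1 (i | i) (j | j) <;> simp [diagOne, splitIndex]
  have h2 : (Matrix.fromBlocks V 0 0 (1 : Matrix (Fin n) (Fin n) ℂ)).map C =
      (diagOne (Fin n) (V.submatrix id (finSumFinEquiv.trans (finCongr h)).symm)).submatrix
        id (splitIndex h n).symm := by
    ext1 (i | i) (j | j) <;> simp [diagOne, splitIndex]
  rw [h1, h2]
  rfl

theorem mainTheorem2 (d m n : ℕ)
    (A : Pencil (Fin d) (Fin d)) (B : Pencil (Fin d) (Fin n))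
    (C : Pencil (Fin m) (Fin d)) (D : Pencil (Fin m) (Fin n))
    (R : Matrix (Fin m) (Fin n) (RatFunc ℂ))
    (hR : Realizes A B C D R) :
    ∃ (r s : ℕ) (h : r + s = d)
      (U V : Matrix (Fin d) (Fin d) ℂ)
      (W₁₁ : Matrix (Fin r) (Fin r) ℂ) (W₁₃ : Matrix (Fin r) (Fin n) ℂ)
      (W₃₁ : Matrix (Fin n) (Fin r) ℂ) (W₃₃ : Matrix (Fin n) (Fin n) ℂ)
      (Xc : Pencil (Fin r) (Fin r)) (Yc : Pencil (Fin s) (Fin r)) (Zc : Pencil (Fin m) (Fin r))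
      (Ac : Pencil (Fin s) (Fin s)) (Bc : Pencil (Fin s) (Fin n))
      (Cc : Pencil (Fin m) (Fin s)) (Dc : Pencil (Fin m) (Fin n)),
      U ∈ Matrix.unitaryGroup (Fin d) ℂ ∧
      V ∈ Matrix.unitaryGroup (Fin d) ℂ ∧
      (blockW W₁₁ W₁₃ W₃₁ W₃₃ : Matrix ((Fin r ⊕ Fin s) ⊕ Fin n) ((Fin r ⊕ Fin s) ⊕ Fin n) ℂ) ∈
        Matrix.unitaryGroup ((Fin r ⊕ Fin s) ⊕ Fin n) ℂ ∧
      Matrix.reindex (splitIndex h m) (splitIndex h n)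
          (diagOne (Fin m) U * systemMatrix A B C D * diagOne (Fin n) V) *
          (blockW W₁₁ W₁₃ W₃₁ W₃₃).map Polynomial.C =
        blockTriangular Xc Yc Zc Ac Bc Cc Dc ∧
      r = (A.fromCols (-B)).numEigenvalues ∧
      Xc.IsRegular ∧
      (∀ z : OnePoint ℂ, (A.fromCols (-B)).blockSizes z = Xc.blockSizes z) ∧
      (∀ z : OnePoint ℂ, ¬ (Ac.fromCols (-Bc)).IsEigenvalue z) ∧
      Realizes Ac Bc Cc Dc (R * W₃₃.map (RatFunc.C)) ∧
      IsUnit W₃₃.det ∧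
      ((∀ z : OnePoint ℂ, ¬ (A.fromRows C).IsEigenvalue z) →
        ∀ z : OnePoint ℂ, ¬ (Ac.fromRows Cc).IsEigenvalue z) := by
  classical
  obtain ⟨hA, hRe⟩ := hR
  obtain ⟨S, L, h₁, h₀, hdim, hsurj⟩ := exists_deflating_pair
    (A.fromCols (-B)).lead.mulVecLin (A.fromCols (-B)).const.mulVecLin n
    (by simp) (exists_surjective_fromCols hA (-B))
  have hLd : Module.finrank ℂ L ≤ d := by
    simpa using Submodule.finrank_le L
  obtain ⟨s, hs⟩ : ∃ s, s = Module.finrank ℂ L := ⟨_, rfl⟩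
  obtain ⟨r, h⟩ : ∃ r, r + s = d := ⟨d - s, by omega⟩
  obtain ⟨Q, V, W₁₁, W₁₃, W₃₁, W₃₃, hQ, hQ', hV, hV', hW, hz₁, hz₀, hrow⟩ :=
    exists_staircase (ρ := Fin r) (σ := Fin s) (ν := Fin n) (A.fromCols (-B)).lead
      (A.fromCols (-B)).const S L h₁ h₀ (by simp [hs]) (by simp [hdim, hs]) (by simp [h])
      (fun α β hαβ y hy => by
        obtain ⟨x, hx, hxy⟩ := hsurj α β hαβ hy
        exact ⟨x, hx, by rw [← hxy, mulVecLin_smul_sub_smul_apply]⟩)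
  obtain ⟨Q₁, Q₂, rfl⟩ : ∃ Q₁ Q₂, Q = Matrix.fromCols Q₁ Q₂ :=
    ⟨_, _, (Matrix.fromCols_toCols Q).symm⟩
  obtain ⟨V₁, V₂, rfl⟩ : ∃ V₁ V₂, V = Matrix.fromCols V₁ V₂ :=
    ⟨_, _, (Matrix.fromCols_toCols V).symm⟩
  simp only [Matrix.toCols₁_fromCols, Matrix.toCols₂_fromCols] at hz₁ hz₀ hrow
  let e : Fin d ≃ Fin r ⊕ Fin s := (finSumFinEquiv.trans (finCongr h)).symm
  obtain ⟨Xc, Yc, Zc, Ac, Bc, Cc, Dc, heq, hX, hblock, hAc, hreal, hunit, hobs⟩ :=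
    exists_blockTriangular e A B C D hA hQ' hV hV' hW hz₁ hz₀ hrow
  refine ⟨r, s, h, (Matrix.fromCols Q₁ Q₂).conjTranspose.submatrix e id,
    (Matrix.fromCols V₁ V₂).submatrix id e, W₁₁, W₁₃, W₃₁, W₃₃, Xc, Yc, Zc, Ac, Bc, Cc, Dc,
    ?_, ?_, blockW_mem_unitaryGroup hW, ?_, ?_, hX, hblock, hAc, hRe ▸ hreal, hunit, hobs⟩
  · rw [Matrix.mem_unitaryGroup_iff, Matrix.star_eq_conjTranspose, Matrix.conjTranspose_submatrix,
      Matrix.conjTranspose_conjTranspose]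
    change ((Matrix.fromCols Q₁ Q₂).conjTranspose * Matrix.fromCols Q₁ Q₂).submatrix e e = 1
    rw [hQ, Matrix.submatrix_one_equiv]
  · rw [Matrix.mem_unitaryGroup_iff, Matrix.star_eq_conjTranspose, Matrix.conjTranspose_submatrix,
      Matrix.submatrix_mul_equiv, hV', Matrix.submatrix_id_id]
  · rw [reindex_diagOne_mul h]
    exact heq
  -- The regular pencil `Xc` has exactly `r` eigenvalues, and the block sizes agree at every point.
  · have := hX.numEigenvalues_eq
    rw [Fintype.card_fin] at this
    rw [← this]
    simp only [Pencil.numEigenvalues, hblock]
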